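/- Let $n\ge 2$ be an integer, $1<\gamma\le\infty$, $\alpha>1-\frac1n$, let $A_{1,\gamma}=\{x\in\mathbb R^n: 1<|x|<\gamma\}$ and $u(x)=(\log|x|)^\alpha$, and put \[ Q_{\alpha,n}=\frac{\alpha^n}{n\alpha-n+1}. \] For an open set $\Omega\subset\mathbb R^n$ and $Q\ge1$, a function $w\in W^{1,n}_{\rm loc}(\Omega)$ is a $Q$-quasiminimizer in $\Omega$ if \[ \int_{\{x\in\Omega:\varphi(x)\ne0\}}|\nabla w|^n\,dx\le Q\int_{\{x\in\Omega:\varphi(x)\ne0\}}|\nabla(w+\varphi)|^n\,dx \] for all $\varphi\in W^{1,n}_0(\Omega)$ (the closure of $C_c^\infty(\Omega)$ in $W^{1,n}(\Omega)$); it is a $Q$-quasisuperminimizer if this holds for all nonnegative $\varphi\in W^{1,n}_0(\Omega)$, and a $Q$-quasisubminimizer if $-w$ is a $Q$-quasisuperminimizer. A minimizer is a $1$-quasiminimizer. Then $u$ is a quasiminimizer in $A_{1,\gamma}$, and the smallest $Q\ge1$ for which it is a $Q$-quasiminimizer in $A_{1,\gamma}$ is $Q_{\alpha,n}$. Moreover,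 the smallest $Q\ge 1$ for which $u$ is a $Q$-quasisubminimizer, respectively a $Q$-quasisuperminimizer, in $A_{1,\gamma}$ exists and is - $Q_{\alpha,n}$, respectively $1$, if $1-\frac1n<\alpha<1$; - $1$, respectively $1$, if $\alpha=1$ (and then also $Q_{\alpha,n}=1$); - $1$, respectively $Q_{\alpha,n}$, if $\alpha>1$. Furthermore, if $\gamma<\infty$, then $u$ has the maximal $n$-energy allowed by $Q_{\alpha,n}$ on $A_{1,\gamma}$, i.e. \[ \int_{A_{1,\gamma}}|\nabla u|^n\,dx=Q_{\alpha,n}\int_{A_{1,\gamma}}|\nabla v|^n\,dx<\infty, \] where $v$ is the minimizer in $A_{1,\gamma}$ with boundary values $v=u$ on $\partial A_{1,\gamma}$, in the sense that $v-u\in W^{1,n}_0(A_{1,\gamma})$. -/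

import Mathlib

open MeasureTheory Filter Topology Set
open scoped ENNReal ContDiff Gradient

namespace QuasiMin

/-- Smooth functions with compact support in `Ω`. -/
def IsTestFunction {n : ℕ} (Ω : Set (EuclideanSpace ℝ (Fin n)))
    (ψ : EuclideanSpace ℝ (Fin n) → ℝ) : Prop :=
  ContDiff ℝ ∞ ψ ∧ HasCompactSupport ψ ∧ tsupport ψ ⊆ Ω

/-- The locally integrable vector field `g` is the weak (distributional) gradient of the locally
integrable function `u` in the open set `Ω`. It is unique up to a null subset of `Ω`. Only the
values of `u` and `g` in `Ω` matter. -/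
def HasWeakGradient {n : ℕ} (Ω : Set (EuclideanSpace ℝ (Fin n)))
    (u : EuclideanSpace ℝ (Fin n) → ℝ)
    (g : EuclideanSpace ℝ (Fin n) → EuclideanSpace ℝ (Fin n)) : Prop :=
  LocallyIntegrableOn u Ω volume ∧ LocallyIntegrableOn g Ω volume ∧
    ∀ ψ : EuclideanSpace ℝ (Fin n) → ℝ, IsTestFunction Ω ψ →
      ∫ x in Ω, u x • ∇ ψ x = -∫ x in Ω, ψ x • g x

/-- `u ∈ W^{1,p}(Ω)`, with weak gradient `g`. -/
def MemSobolev {n : ℕ} (p : ℝ) (Ω : Set (EuclideanSpace ℝ (Fin n)))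
    (u : EuclideanSpace ℝ (Fin n) → ℝ)
    (g : EuclideanSpace ℝ (Fin n) → EuclideanSpace ℝ (Fin n)) : Prop :=
  HasWeakGradient Ω u g ∧ MemLp u (ENNReal.ofReal p) (volume.restrict Ω) ∧
    MemLp g (ENNReal.ofReal p) (volume.restrict Ω)

/-- `u ∈ W^{1,p}_loc(Ω)`, with weak gradient `g`. -/
def MemSobolevLoc {n : ℕ} (p : ℝ) (Ω : Set (EuclideanSpace ℝ (Fin n)))
    (u : EuclideanSpace ℝ (Fin n) → ℝ)
    (g : EuclideanSpace ℝ (Fin n) → EuclideanSpace ℝ (Fin n)) : Prop :=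
  HasWeakGradient Ω u g ∧ ∀ K : Set (EuclideanSpace ℝ (Fin n)), IsCompact K → K ⊆ Ω →
    MemLp u (ENNReal.ofReal p) (volume.restrict K) ∧
      MemLp g (ENNReal.ofReal p) (volume.restrict K)

/-- `φ ∈ W^{1,p}_0(Ω)`, with weak gradient `h`: the closure of the test functions in the
`W^{1,p}(Ω)`-norm. -/
def MemSobolevZero {n : ℕ} (p : ℝ) (Ω : Set (EuclideanSpace ℝ (Fin n)))
    (φ : EuclideanSpace ℝ (Fin n) → ℝ)
    (h : EuclideanSpace ℝ (Fin n) → EuclideanSpace ℝ (Fin n)) : Prop :=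
  MemSobolev p Ω φ h ∧ ∃ ψ : ℕ → EuclideanSpace ℝ (Fin n) → ℝ,
    (∀ k, IsTestFunction Ω (ψ k)) ∧
    Tendsto (fun k => eLpNorm (fun x => ψ k x - φ x) (ENNReal.ofReal p) (volume.restrict Ω))
      atTop (𝓝 0) ∧
    Tendsto (fun k => eLpNorm (fun x => ∇ (ψ k) x - h x) (ENNReal.ofReal p) (volume.restrict Ω))
      atTop (𝓝 0)

/-- The `p`-energy `∫_S |g|^p dx ∈ [0, ∞]` of a function with gradient `g` on the set `S`. -/
noncomputable def energy {n : ℕ} (p : ℝ) (S : Set (EuclideanSpace ℝ (Fin n)))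
    (g : EuclideanSpace ℝ (Fin n) → EuclideanSpace ℝ (Fin n)) : ℝ≥0∞ :=
  ∫⁻ x in S, ‖g x‖ₑ ^ p

/-- `u` is a `Q`-quasiminimizer in `Ω`. Here `g = ∇u` and `h = ∇φ`, so `g + h = ∇(u + φ)`. -/
def IsQuasiminimizer {n : ℕ} (p Q : ℝ) (Ω : Set (EuclideanSpace ℝ (Fin n)))
    (u : EuclideanSpace ℝ (Fin n) → ℝ) : Prop :=
  1 ≤ Q ∧ ∃ g, MemSobolevLoc p Ω u g ∧ ∀ φ h, MemSobolevZero p Ω φ h →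
    energy p {x ∈ Ω | φ x ≠ 0} g ≤ ENNReal.ofReal Q * energy p {x ∈ Ω | φ x ≠ 0} (g + h)

/-- `u` is a `Q`-quasisuperminimizer in `Ω`: the same with nonnegative `φ` only. -/
def IsQuasisuperminimizer {n : ℕ} (p Q : ℝ) (Ω : Set (EuclideanSpace ℝ (Fin n)))
    (u : EuclideanSpace ℝ (Fin n) → ℝ) : Prop :=
  1 ≤ Q ∧ ∃ g, MemSobolevLoc p Ω u g ∧ ∀ φ h, MemSobolevZero p Ω φ h →
    (∀ᵐ x ∂(volume.restrict Ω), 0 ≤ φ x) →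
    energy p {x ∈ Ω | φ x ≠ 0} g ≤ ENNReal.ofReal Q * energy p {x ∈ Ω | φ x ≠ 0} (g + h)

/-- `u` is a `Q`-quasisubminimizer in `Ω` if `-u` is a `Q`-quasisuperminimizer. -/
def IsQuasisubminimizer {n : ℕ} (p Q : ℝ) (Ω : Set (EuclideanSpace ℝ (Fin n)))
    (u : EuclideanSpace ℝ (Fin n) → ℝ) : Prop :=
  IsQuasisuperminimizer p Q Ω (-u)

/-- The `Q`-quasiminimizer `u` in `Ω` has the maximal `p`-energy allowed by `Q` on the open set
`G ⊆ Ω`: `∫_G |∇u|^p = Q ∫_G |∇v|^p < ∞`, where `v` is the minimizer in `G` with boundary values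
`v = u` on `∂G`, that is `v - u ∈ W^{1,p}_0(G)`. Here `g = ∇u` and `w = ∇v`. -/
def HasMaximalEnergy {n : ℕ} (p Q : ℝ) (Ω G : Set (EuclideanSpace ℝ (Fin n)))
    (u : EuclideanSpace ℝ (Fin n) → ℝ) : Prop :=
  IsQuasiminimizer p Q Ω u ∧ IsOpen G ∧ G ⊆ Ω ∧
    ∃ g v w, MemSobolevLoc p Ω u g ∧ MemSobolevLoc p G v w ∧ IsQuasiminimizer p 1 G v ∧
      MemSobolevZero p G (v - u) (w - g) ∧
      energy p G g = ENNReal.ofReal Q * energy p G w ∧ energy p G g < ⊤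

/-- The annulus `A_{r₁,r₂} = {x ∈ ℝⁿ : r₁ < |x| < r₂}`, where `r₂ = ∞` is allowed. -/
def annulus (n : ℕ) (r₁ r₂ : ℝ≥0∞) : Set (EuclideanSpace ℝ (Fin n)) :=
  {x | r₁ < ‖x‖ₑ ∧ ‖x‖ₑ < r₂}

/-- The log-power `x ↦ (log |x|)^α` (it is used only where `|x| > 1`). -/
noncomputable def logPower (n : ℕ) (α : ℝ) (x : EuclideanSpace ℝ (Fin n)) : ℝ :=
  Real.log ‖x‖ ^ α

/-- The constant `Q_{α,n} = α^n / (nα - n + 1)`. -/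
noncomputable def logPowerConst (n : ℕ) (α : ℝ) : ℝ :=
  α ^ n / (n * α - n + 1)

end QuasiMin

/-! In the coordinates x = e^t θ, with t real and θ on the unit sphere, the n-energy loses its
weight: e^{nt}|∇w|^n dt dθ is the energy element, and e^t ∂_r w = ∂_t w. The function u becomes t^α,
independent of θ. Its gradient is purely radial, so for a perturbation φ the energy of u + φ is
bounded below by the energy of its t-derivative alone. This reduces every upper bound to a
comparison on almost every ray (`energy_logPowerGrad_le`), where φ is the primitive of some f in L^n
that vanishes for t ≤ 0 (`ae_ray_eq_integral`).

On a ray, {φ ≠ 0} is an open subset of (0, ∞), and each component can be treated alone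
(`setLIntegral_le_of_components`). An unbounded component carries infinite energy on both sides. On
a component (a, b) put β = nα - n + 1 > 0. The energy of t^α is Q_{α,n}(b^β - a^β), while Hölder's
inequality gives every function with the same end values energy at least (b^α - a^α)^n / (b -
a)^{n-1}. The constant Q_{α,n} thus follows from (b^β - a^β)(b - a)^{n-1} ≤ (b^α - a^α)^n, which is
`rpow_sub_mul_le`.

For perturbations of one sign the constant 1 comes from convexity: the energy of t^α + φ exceeds
that of t^α by at least a positive multiple of ∫ t^m φ' dt, with m = (α-1)(n-1). Integration by
parts turns this integral into -m ∫ t^{m-1} φ dt, which is nonnegative when (α-1)φ ≤ 0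
(`lintegral_deriv_rpow_le_of_sign`).

For sharpness, equality holds above when a = 0 and the competitor is affine in t. Replacing t^α on
(0, b) by its chord b^{α-1} t divides the energy by exactly Q_{α,n}
(`energy_logPowerGrad_eq_mul_energy_chord`). The chord lies above t^α if α > 1 and below it if α <
1, which decides between super- and subminimizers. That the perturbation lies in W^{1,n}_0 is
`memSobolevZero_radial`. With b = log γ the chord is the minimizer with boundary values u, since α =
1 gives the constant 1; hence the maximal energy. -/

namespace QuasiMin

/-! ### Logarithmic polar coordinates -/

/-- Integration in logarithmic polar coordinates. -/
lemma lintegral_logPolar {n : ℕ} (hn : 1 ≤ n) {F : EuclideanSpace ℝ (Fin n) → ℝ≥0∞}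
    (hF : Measurable F) :
    ∫⁻ x, F x = ∫⁻ θ : Metric.sphere (0 : EuclideanSpace ℝ (Fin n)) 1,
      (∫⁻ t : ℝ, ENNReal.ofReal (Real.exp t) ^ n *
        F (Real.exp t • (θ : EuclideanSpace ℝ (Fin n))))
      ∂(volume : Measure (EuclideanSpace ℝ (Fin n))).toSphere := by
  have hE : Nontrivial (EuclideanSpace ℝ (Fin n)) := by
    have : Nonempty (Fin n) := ⟨⟨0, hn⟩⟩
    infer_instance
  have h1 : ∫⁻ x, F x = ∫⁻ x : ({(0 : EuclideanSpace ℝ (Fin n))}ᶜ : Set _), F x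
      ∂((volume : Measure (EuclideanSpace ℝ (Fin n))).comap Subtype.val) := by
    rw [lintegral_subtype_comap (measurableSet_singleton _).compl F, restrict_compl_singleton]
  have h2 := (volume : Measure (EuclideanSpace ℝ (Fin n))).measurePreserving_homeomorphUnitSphereProd
  have hG : Measurable fun p : Metric.sphere (0 : EuclideanSpace ℝ (Fin n)) 1 × Ioi (0 : ℝ) =>
      F ((p.2 : ℝ) • (p.1 : EuclideanSpace ℝ (Fin n))) := hF.comp (by fun_prop)
  have h3 := h2.lintegral_comp hG
  rw [h1]
  have h4 : ∀ x : ({(0 : EuclideanSpace ℝ (Fin n))}ᶜ : Set _),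
      F ((((homeomorphUnitSphereProd (EuclideanSpace ℝ (Fin n))) x).2 : ℝ) •
        (((homeomorphUnitSphereProd (EuclideanSpace ℝ (Fin n))) x).1 :
          EuclideanSpace ℝ (Fin n))) = F x := by
    rintro ⟨x, hx⟩
    have : ‖x‖ ≠ 0 := by simpa using hx
    simp [smul_smul, this]
  simp only [h4] at h3
  rw [h3, lintegral_prod _ hG.aemeasurable]
  refine lintegral_congr fun θ => ?_
  have hFm : Measurable fun r : ℝ => F (r • (θ : EuclideanSpace ℝ (Fin n))) :=
    hF.comp (by fun_prop)
  have h5 := lintegral_withDensity_eq_lintegral_mul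
    ((volume : Measure ℝ).comap ((↑) : Ioi (0 : ℝ) → ℝ))
    (f := fun r : Ioi (0 : ℝ) =>
      ENNReal.ofReal ((r : ℝ) ^ (Module.finrank ℝ (EuclideanSpace ℝ (Fin n)) - 1))) (by fun_prop)
    (hFm.comp measurable_subtype_coe)
  simp only [Function.comp_def] at h5
  rw [Measure.volumeIoiPow, h5]
  simp only [Pi.mul_apply, finrank_euclideanSpace_fin]
  rw [lintegral_subtype_comap measurableSet_Ioi
    (fun r : ℝ => ENNReal.ofReal (r ^ (n - 1)) * F (r • (θ : EuclideanSpace ℝ (Fin n)))),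
    ← Real.range_exp, ← image_univ, lintegral_image_eq_lintegral_abs_deriv_mul MeasurableSet.univ
    (fun t _ => (Real.hasDerivAt_exp t).hasDerivWithinAt) Real.exp_injective.injOn]
  rw [setLIntegral_univ]
  refine lintegral_congr fun t => ?_
  -- The Jacobian e^t of r = e^t joins the weight r^{n-1} to give e^{nt}.
  rw [← mul_assoc, ← ENNReal.ofReal_mul (abs_nonneg _), abs_of_pos (Real.exp_pos t),
    ← ENNReal.ofReal_pow (Real.exp_pos t).le, ← pow_succ', Nat.sub_add_cancel hn]

/-! ### The sharp power inequality and Hölder's inequality -/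

lemma pos_of_one_sub_inv_lt {n : ℕ} (hn : 2 ≤ n) {α : ℝ} (hα : 1 - 1 / (n : ℝ) < α) : 0 < α := by
  have h2 : (2 : ℝ) ≤ n := by exact_mod_cast hn
  have : 1 / (n : ℝ) ≤ 1 := by rw [div_le_one (by linarith)]; linarith
  linarith

/-- This is the assumption on α in the form in which it is used: β = nα - n + 1 is one more than the
exponent of t in the energy density of t^α, so positivity means finite energy near t = 0 and
infinite energy near ∞. -/
lemma logPowerConst_denom_pos {n : ℕ} (hn : 2 ≤ n) {α : ℝ} (hα : 1 - 1 / (n : ℝ) < α) :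
    0 < (n : ℝ) * α - n + 1 := by
  have h2 : (2 : ℝ) ≤ n := by exact_mod_cast hn
  have h0 : (0 : ℝ) < n := by linarith
  have := mul_lt_mul_of_pos_left hα h0
  have h3 : (n : ℝ) * (1 - 1 / n) = n - 1 := by field_simp
  linarith

/-- Bernoulli's inequality for (1 + (α - 1))^n, whose linear lower bound is exactly the denominator.
-/
lemma one_le_logPowerConst {n : ℕ} (hn : 2 ≤ n) {α : ℝ} (hα : 1 - 1 / (n : ℝ) < α) :
    1 ≤ logPowerConst n α := by
  rw [logPowerConst, one_le_div (logPowerConst_denom_pos hn hα)]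
  have := one_add_mul_le_pow (a := α - 1) (by linarith [pos_of_one_sub_inv_lt hn hα]) n
  simp only [add_sub_cancel] at this
  linarith

/-- The power-function inequality behind the optimal constant; it is the superadditivity of a
weighted geometric mean. -/
lemma rpow_sub_mul_le {n : ℕ} (hn : 2 ≤ n) {α a b : ℝ} (hα : 1 - 1 / (n : ℝ) < α) (ha : 0 ≤ a)
    (hab : a < b) :
    (b ^ ((n : ℝ) * α - n + 1) - a ^ ((n : ℝ) * α - n + 1)) * (b - a) ^ (n - 1) ≤
      (b ^ α - a ^ α) ^ n := by
  have hβ := logPowerConst_denom_pos hn hα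
  have hα0 := pos_of_one_sub_inv_lt hn hα
  set β : ℝ := (n : ℝ) * α - n + 1 with hβd
  have hn1 : (1 : ℝ) < n := by exact_mod_cast hn
  have hn0 : (0 : ℝ) < n := by linarith
  have hb : 0 < b := ha.trans_lt hab
  have hA : 0 ≤ b ^ β - a ^ β := sub_nonneg.2 (Real.rpow_le_rpow ha hab.le hβ.le)
  have hB : 0 ≤ b - a := by linarith
  have hpq : (n : ℝ).HolderConjugate (n / (n - 1)) := by
    rw [Real.holderConjugate_iff]; refine ⟨hn1, ?_⟩
    have : (n : ℝ) - 1 ≠ 0 := by linarith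
    field_simp; ring
  set A := b ^ β - a ^ β with hAd
  set m : ℝ := 1 / (n / (n - 1)) with hm
  have hm' : m = (n - 1) / n := by rw [hm, one_div_div]
  have hm0 : 0 < m := by rw [hm']; exact div_pos (by linarith) hn0
  -- Hölder on two points. Since α = β/n + (n-1)/n, the power t^α is the weighted geometric mean of
  -- t^β and t. The first entries carry the increments from a to b, the second ones the values at a,
  -- and the right-hand side is the mean at b, namely b^α.
  have key := Real.inner_le_Lp_mul_Lq_of_nonneg (Finset.univ : Finset (Fin 2)) hpq
    (f := ![A ^ (1 / (n : ℝ)), (a ^ β) ^ (1 / (n : ℝ))]) (g := ![(b - a) ^ m, a ^ m])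
    (by intro i _; fin_cases i <;> simp <;> positivity)
    (by intro i _; fin_cases i <;> simp <;> positivity)
  have hcancel : ∀ x : ℝ, 0 ≤ x → (x ^ (1 / (n : ℝ))) ^ (n : ℝ) = x := fun x hx => by
    rw [← Real.rpow_mul hx, one_div_mul_cancel hn0.ne', Real.rpow_one]
  have hcancel' : ∀ x : ℝ, 0 ≤ x → (x ^ m) ^ ((n : ℝ) / (n - 1)) = x := fun x hx => by
    rw [← Real.rpow_mul hx, hm, one_div_mul_cancel, Real.rpow_one]
    exact (div_pos hn0 (by linarith)).ne'
  have hcomb : ∀ x : ℝ, 0 ≤ x → (x ^ β) ^ (1 / (n : ℝ)) * x ^ m = x ^ α := fun x hx => by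
    rw [← Real.rpow_mul hx, ← Real.rpow_add_of_nonneg hx (by positivity) hm0.le]
    congr 1
    rw [hm', hβd]; field_simp; ring
  simp only [Fin.sum_univ_two, Matrix.cons_val_zero, Matrix.cons_val_one] at key
  rw [hcancel _ hA, hcancel _ (by positivity), hcancel' _ hB, hcancel' _ ha, hcomb a ha,
    sub_add_cancel, sub_add_cancel, ← hm, hcomb b hb.le] at key
  have h1 : A ^ (1 / (n : ℝ)) * (b - a) ^ m ≤ b ^ α - a ^ α := by linarith
  have h2 := pow_le_pow_left₀ (by positivity) h1 n
  refine le_trans (le_of_eq ?_) h2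
  rw [mul_pow, ← Real.rpow_natCast (A ^ _) n, hcancel _ hA]
  congr 1
  rw [← Real.rpow_natCast, ← Real.rpow_natCast, ← Real.rpow_mul hB, hm', div_mul_cancel₀ _ hn0.ne']
  rw [Nat.cast_sub (by omega)]; simp

/-- Hölder's inequality against the constant function. -/
lemma lintegral_pow_le_measure_mul {X : Type*} [MeasurableSpace X] {μ : Measure X} {n : ℕ}
    (hn : 2 ≤ n) {F : X → ℝ≥0∞} (hF : AEMeasurable F μ) :
    (∫⁻ x, F x ∂μ) ^ n ≤ μ univ ^ (n - 1) * ∫⁻ x, F x ^ n ∂μ := by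
  have hn1 : (1 : ℝ) < n := by exact_mod_cast hn
  have hn0 : (0 : ℝ) < n := by linarith
  have hpq : (n : ℝ).HolderConjugate (n / (n - 1)) := by
    rw [Real.holderConjugate_iff]; refine ⟨hn1, ?_⟩
    have : (n : ℝ) - 1 ≠ 0 := by linarith
    field_simp; ring
  have h := ENNReal.lintegral_mul_le_Lp_mul_Lq μ hpq hF (aemeasurable_const (b := (1 : ℝ≥0∞)))
  simp only [Pi.mul_apply, mul_one, ENNReal.one_rpow, lintegral_one, ENNReal.rpow_natCast,
    one_div_div] at h
  have h2 := pow_le_pow_left₀ (zero_le) h n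
  refine h2.trans (le_of_eq ?_)
  rw [mul_pow, ← ENNReal.rpow_natCast (_ ^ (1 / (n : ℝ))) n, ← ENNReal.rpow_mul,
    one_div_mul_cancel hn0.ne', ENNReal.rpow_one, mul_comm]
  congr 1
  rw [← ENNReal.rpow_natCast, ← ENNReal.rpow_natCast, ← ENNReal.rpow_mul,
    div_mul_cancel₀ _ hn0.ne', Nat.cast_sub (by omega)]
  simp

/-! ### Energy comparison on one interval -/

/-- The one-dimensional energy density of `t ↦ c * t ^ α`. -/
lemma enorm_deriv_rpow_pow {n : ℕ} {c α t : ℝ} (hc : 0 ≤ c) (hα : 0 < α) (ht : 0 < t) :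
    ‖c * α * t ^ (α - 1)‖ₑ ^ n =
      ENNReal.ofReal (c ^ n * α ^ n * t ^ ((n : ℝ) * α - n)) := by
  have h : 0 ≤ c * α * t ^ (α - 1) := by positivity
  rw [Real.enorm_of_nonneg h, ← ENNReal.ofReal_pow h]
  congr 1
  rw [mul_pow, mul_pow, ← Real.rpow_natCast (t ^ _), ← Real.rpow_mul ht.le]
  ring_nf

lemma lintegral_deriv_rpow_pow {n : ℕ} (hn : 2 ≤ n) {c α a b : ℝ} (hα : 1 - 1 / (n : ℝ) < α)
    (hc : 0 ≤ c) (ha : 0 ≤ a) (hab : a ≤ b) :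
    ∫⁻ t in Ioo a b, ‖c * α * t ^ (α - 1)‖ₑ ^ n =
      ENNReal.ofReal (c ^ n * logPowerConst n α *
        (b ^ ((n : ℝ) * α - n + 1) - a ^ ((n : ℝ) * α - n + 1))) := by
  have hβ := logPowerConst_denom_pos hn hα
  have hα0 := pos_of_one_sub_inv_lt hn hα
  have hlt : -1 < (n : ℝ) * α - n := by linarith
  have hI := intervalIntegral.intervalIntegrable_rpow' (a := a) (b := b) hlt
  rw [setLIntegral_congr_fun measurableSet_Ioo
    (fun t ht => enorm_deriv_rpow_pow hc hα0 (ha.trans_lt ht.1)),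
    restrict_Ioo_eq_restrict_Ioc, ← ofReal_integral_eq_lintegral_ofReal]
  · rw [← intervalIntegral.integral_of_le hab, intervalIntegral.integral_const_mul,
      integral_rpow (Or.inl hlt), logPowerConst]
    congr 1
    field_simp
  · exact (hI.1).const_mul _
  · filter_upwards [ae_restrict_mem measurableSet_Ioc] with t ht
    have : 0 ≤ t := ha.trans ht.1.le
    positivity

lemma lintegral_deriv_rpow_pow_Ioi {n : ℕ} (hn : 2 ≤ n) {c α a : ℝ} (hα : 1 - 1 / (n : ℝ) < α)
    (hc : 0 < c) (ha : 0 ≤ a) :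
    ∫⁻ t in Ioi a, ‖c * α * t ^ (α - 1)‖ₑ ^ n = ⊤ := by
  have hβ := logPowerConst_denom_pos hn hα
  have hQ : 0 < logPowerConst n α := one_pos.trans_le (one_le_logPowerConst hn hα)
  have hle : ∀ᶠ b : ℝ in atTop, ENNReal.ofReal (c ^ n * logPowerConst n α *
        (b ^ ((n : ℝ) * α - n + 1) - a ^ ((n : ℝ) * α - n + 1))) ≤
      ∫⁻ t in Ioi a, ‖c * α * t ^ (α - 1)‖ₑ ^ n := by
    filter_upwards [eventually_ge_atTop a] with b hb
    rw [← lintegral_deriv_rpow_pow hn hα hc.le ha hb]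
    exact lintegral_mono_set Ioo_subset_Ioi_self
  have hT : Tendsto (fun b : ℝ => ENNReal.ofReal (c ^ n * logPowerConst n α *
        (b ^ ((n : ℝ) * α - n + 1) - a ^ ((n : ℝ) * α - n + 1)))) atTop (𝓝 ⊤) := by
    refine ENNReal.tendsto_ofReal_atTop.comp (Tendsto.const_mul_atTop (by positivity) ?_)
    exact tendsto_atTop_add_const_right _ _ (tendsto_rpow_atTop hβ)
  exact top_le_iff.1 (le_of_tendsto hT hle)

/-- The sharp one-dimensional energy comparison on a bounded interval. -/
lemma lintegral_deriv_rpow_le_of_integral_eq_zero {n : ℕ} (hn : 2 ≤ n) {c α a b : ℝ}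
    (hα : 1 - 1 / (n : ℝ) < α) (hc : 0 ≤ c) (ha : 0 ≤ a) (hab : a < b) {f : ℝ → ℝ}
    (hf : IntervalIntegrable f volume a b) (h0 : ∫ t in a..b, f t = 0) :
    ∫⁻ t in Ioo a b, ‖c * α * t ^ (α - 1)‖ₑ ^ n ≤
      ENNReal.ofReal (logPowerConst n α) *
        ∫⁻ t in Ioo a b, ‖c * α * t ^ (α - 1) + f t‖ₑ ^ n := by
  have hβ := logPowerConst_denom_pos hn hα
  have hα0 := pos_of_one_sub_inv_lt hn hα
  have hQ : 0 < logPowerConst n α := one_pos.trans_le (one_le_logPowerConst hn hα)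
  have hI : IntervalIntegrable (fun t : ℝ => c * α * t ^ (α - 1)) volume a b :=
    (intervalIntegral.intervalIntegrable_rpow' (by linarith)).const_mul _
  have hint : ∫ t in a..b, (c * α * t ^ (α - 1) + f t) = c * (b ^ α - a ^ α) := by
    rw [intervalIntegral.integral_add hI hf, h0, intervalIntegral.integral_const_mul,
      integral_rpow (Or.inl (by linarith))]
    simp only [sub_add_cancel]
    field_simp
    ring
  have hpos : 0 ≤ b ^ α - a ^ α := sub_nonneg.2 (Real.rpow_le_rpow ha hab.le hα0.le)
  have hAE := (hI.add hf).1.aestronglyMeasurable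
  rw [← restrict_Ioo_eq_restrict_Ioc] at hAE
  -- As f has mean zero, the competitor has the same total increment as c t^α; its total variation
  -- is at least that.
  have h1 : ENNReal.ofReal (c * (b ^ α - a ^ α)) ≤
      ∫⁻ t in Ioo a b, ‖c * α * t ^ (α - 1) + f t‖ₑ := by
    rw [← hint, ← Real.enorm_of_nonneg (by rw [hint]; positivity),
      intervalIntegral.integral_of_le hab.le, ← restrict_Ioo_eq_restrict_Ioc]
    exact enorm_integral_le_lintegral_enorm _
  have h2 := (pow_le_pow_left₀ zero_le h1 n).trans
    (lintegral_pow_le_measure_mul hn hAE.aemeasurable.enorm)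
  simp only [Measure.restrict_apply_univ, Real.volume_Ioo] at h2
  rw [lintegral_deriv_rpow_pow hn hα hc ha hab.le]
  set L := ∫⁻ t in Ioo a b, ‖c * α * t ^ (α - 1) + f t‖ₑ ^ n with hL
  have hba : 0 < b - a := by linarith
  have h3 : ENNReal.ofReal (b - a) ^ (n - 1) * ENNReal.ofReal (c ^ n *
      (b ^ ((n : ℝ) * α - n + 1) - a ^ ((n : ℝ) * α - n + 1))) ≤
        ENNReal.ofReal (b - a) ^ (n - 1) * L := by
    refine le_trans ?_ h2
    rw [← ENNReal.ofReal_pow hba.le, ← ENNReal.ofReal_mul (by positivity),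
      ← ENNReal.ofReal_pow (by positivity)]
    apply ENNReal.ofReal_le_ofReal
    have := mul_le_mul_of_nonneg_left (rpow_sub_mul_le hn hα ha hab) (pow_nonneg hc n)
    rw [mul_pow]; nlinarith
  have h4 := (ENNReal.mul_le_mul_iff_right (by simp; intro h; linarith) (by simp)).1 h3
  calc _ = ENNReal.ofReal (logPowerConst n α) * ENNReal.ofReal (c ^ n *
      (b ^ ((n : ℝ) * α - n + 1) - a ^ ((n : ℝ) * α - n + 1))) := by
        rw [← ENNReal.ofReal_mul hQ.le]; ring_nf
    _ ≤ _ := by gcongr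

/-- The tangent-line inequality for the convex function |·|^n at x, obtained by scaling Bernoulli's
inequality for |x + y|/x. At x = 0 the linear term vanishes because n ≥ 2. -/
lemma pow_add_mul_le_abs_add_pow {n : ℕ} (hn : 2 ≤ n) {x y : ℝ} (hx : 0 ≤ x) :
    x ^ n + n * (x ^ (n - 1) * y) ≤ |x + y| ^ n := by
  obtain ⟨k, rfl⟩ : ∃ k, n = k + 1 := ⟨n - 1, by omega⟩
  rcases hx.eq_or_lt with rfl | hx
  · have : k ≠ 0 := by omega
    simp [this]
  · have h := one_add_mul_le_pow (a := |x + y| / x - 1)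
      (by have : 0 ≤ |x + y| / x := by positivity
          linarith) (k + 1)
    rw [add_sub_cancel, div_pow, le_div_iff₀ (by positivity)] at h
    refine le_trans ?_ h
    have h1 : y ≤ |x + y| - x := by linarith [le_abs_self (x + y)]
    have h2 : (1 + ((k + 1 : ℕ) : ℝ) * (|x + y| / x - 1)) * x ^ (k + 1) =
        x ^ (k + 1) + ((k + 1 : ℕ) : ℝ) * (x ^ k * (|x + y| - x)) := by
      field_simp
      ring
    rw [h2, Nat.add_sub_cancel]
    gcongr

/-- A crude form of Young's inequality; it makes the linear term of the tangent-line inequality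
integrable. -/
lemma pow_pred_mul_abs_le {n : ℕ} (hn : 2 ≤ n) {x y : ℝ} (hx : 0 ≤ x) :
    x ^ (n - 1) * |y| ≤ x ^ n + |y| ^ n := by
  obtain ⟨k, rfl⟩ : ∃ k, n = k + 1 := ⟨n - 1, by omega⟩
  rw [Nat.add_sub_cancel]
  have hy := abs_nonneg y
  rcases le_total x |y| with h | h
  · have : x ^ k * |y| ≤ |y| ^ (k + 1) := by rw [pow_succ]; gcongr
    have := pow_nonneg hx (k + 1)
    linarith
  · have : x ^ k * |y| ≤ x ^ (k + 1) := by rw [pow_succ]; gcongr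
    have := pow_nonneg hy (k + 1)
    linarith

/-- Hölder's inequality gives the decay of a primitive near its base point, needed to kill the
boundary term at 0 in the integration by parts. -/
lemma abs_integral_pow_le {n : ℕ} (hn : 2 ≤ n) {f : ℝ → ℝ} (hf : MemLp f n) {a b : ℝ}
    (hab : a ≤ b) : |∫ t in a..b, f t| ^ n ≤ (b - a) ^ (n - 1) * ∫ t, |f t| ^ n := by
  have hfn : Integrable (fun t => |f t| ^ n) := by
    simpa using hf.integrable_norm_pow (by omega)
  have h1 : ‖∫ t in a..b, f t‖ₑ ≤ ∫⁻ t in Ioc a b, ‖f t‖ₑ := by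
    rw [intervalIntegral.integral_of_le hab]
    exact enorm_integral_le_lintegral_enorm _
  have h2 := (pow_le_pow_left₀ zero_le h1 n).trans
    (lintegral_pow_le_measure_mul hn hf.1.aemeasurable.enorm.restrict)
  have h3 : ∫⁻ t in Ioc a b, ‖f t‖ₑ ^ n ≤ ENNReal.ofReal (∫ t, |f t| ^ n) := by
    rw [ofReal_integral_eq_lintegral_ofReal hfn (ae_of_all _ fun t => by positivity)]
    refine (setLIntegral_le_lintegral _ _).trans (le_of_eq (lintegral_congr fun t => ?_))
    rw [Real.enorm_eq_ofReal_abs, ENNReal.ofReal_pow (abs_nonneg _)]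
  have hN : 0 ≤ ∫ t, |f t| ^ n := integral_nonneg fun t => by positivity
  have hba : 0 ≤ b - a := sub_nonneg.2 hab
  rw [← ENNReal.ofReal_le_ofReal_iff (by positivity), ENNReal.ofReal_mul (by positivity),
    ENNReal.ofReal_pow (abs_nonneg _), ENNReal.ofReal_pow hba, ← Real.enorm_eq_ofReal_abs]
  refine h2.trans ?_
  simp only [Measure.restrict_apply_univ, Real.volume_Ioc]
  gcongr

/-- Integration by parts against a power whose monotonicity has the right sign. -/
lemma neg_rpow_mul_integral_le {m a s b : ℝ} {f : ℝ → ℝ} (hs : 0 < s) (hsb : s ≤ b)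
    (has : a ≤ s) (hf : LocallyIntegrable f) (hsign : ∀ t ∈ Ioo a b, m * ∫ r in a..t, f r ≤ 0)
    (hb : ∫ r in a..b, f r = 0) :
    -(s ^ m * ∫ r in a..s, f r) ≤ ∫ t in s..b, t ^ m * f t := by
  have hfi : ∀ x y : ℝ, IntervalIntegrable f volume x y := fun x y => (hf.integrableOn_isCompact isCompact_uIcc).intervalIntegrable
  set Φ : ℝ → ℝ := fun t => ∫ r in a..t, f r with hΦ
  -- The primitive of f is only absolutely continuous, so integration by parts is used in that
  -- class; staying on [s, b] with s > 0 keeps t^m smooth even for m < 0.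
  have hΦac : AbsolutelyContinuousOnInterval Φ s b :=
    ((hfi a b).absolutelyContinuousOnInterval_intervalIntegral (c := a) (by simp)).mono (by
      rw [uIcc_of_le hsb, uIcc_of_le (has.trans hsb)]; exact Icc_subset_Icc_left has)
  have hw : AbsolutelyContinuousOnInterval (fun t : ℝ => t ^ m) s b := by
    apply ContDiffOn.absolutelyContinuousOnInterval
    rw [uIcc_of_le hsb]
    exact fun t ht => (Real.contDiffAt_rpow_const_of_ne (hs.trans_le ht.1).ne').contDiffWithinAt
  have hparts := hw.integral_mul_deriv_eq_deriv_mul hΦac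
  have hderiv : ∀ᵐ t, t ∈ uIoc s b → t ^ m * deriv Φ t = t ^ m * f t := by
    filter_upwards [(hfi a b).ae_hasDerivAt_integral] with t ht hts
    rw [uIoc_of_le hsb] at hts
    rw [(ht (by rw [uIcc_of_le (has.trans hsb)]; exact ⟨has.trans hts.1.le, hts.2⟩)
      a (by simp)).deriv]
  rw [intervalIntegral.integral_congr_ae hderiv] at hparts
  rw [hparts]
  have hneg : ∫ t in s..b, deriv (fun t : ℝ => t ^ m) t * Φ t ≤ 0 := by
    rw [intervalIntegral.integral_of_le hsb]
    apply setIntegral_nonpos_ae measurableSet_Ioc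
    have hbne : ∀ᵐ t : ℝ, t ≠ b := by simp [ae_iff]
    filter_upwards [hbne] with t htb ht
    have ht0 : 0 < t := hs.trans ht.1
    rw [Real.deriv_rpow_const]
    have h1 := hsign t ⟨has.trans_lt ht.1, lt_of_le_of_ne ht.2 htb⟩
    have h2 : 0 < t ^ (m - 1) := by positivity
    have : m * t ^ (m - 1) * Φ t = t ^ (m - 1) * (m * Φ t) := by ring
    rw [this]
    exact mul_nonpos_of_nonneg_of_nonpos h2.le h1
  have hb0 : Φ b = 0 := hb
  simp only [hb0]
  linarith

/-- The one-dimensional energy comparison with constant `1` for one-sided perturbations. -/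
lemma lintegral_deriv_rpow_le_of_sign {n : ℕ} (hn : 2 ≤ n) {c α a b : ℝ}
    (hα : 1 - 1 / (n : ℝ) < α) (hc : 0 < c) (ha : 0 ≤ a) (hab : a < b) {f : ℝ → ℝ}
    (hf : MemLp f n) (hsign : ∀ t ∈ Ioo a b, (α - 1) * ∫ s in a..t, f s ≤ 0)
    (h0 : ∫ s in a..b, f s = 0) :
    ∫⁻ t in Ioo a b, ‖c * α * t ^ (α - 1)‖ₑ ^ n ≤
      ∫⁻ t in Ioo a b, ‖c * α * t ^ (α - 1) + f t‖ₑ ^ n := by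
  have hβ := logPowerConst_denom_pos hn hα
  have hα0 := pos_of_one_sub_inv_lt hn hα
  have hn1 : (1 : ℝ) < n := by exact_mod_cast hn
  have hn0 : (0 : ℝ) < n := by linarith
  have hloc : LocallyIntegrable f := hf.locallyIntegrable (by exact_mod_cast (by omega : 1 ≤ n))
  -- The exponent of t in the (n-1)-st power of the derivative of t^α, which is the weight in the
  -- first variation of the energy.
  set m : ℝ := (α - 1) * (n - 1) with hm
  set G : ℝ → ℝ := fun t => c * α * t ^ (α - 1) with hG
  have hGpos : ∀ t ∈ Ioo a b, 0 ≤ G t := fun t ht => by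
    have : 0 < t := ha.trans_lt ht.1
    simp only [hG]; positivity
  have hGw : ∀ t : ℝ, 0 < t → G t ^ (n - 1) = (c * α) ^ (n - 1) * t ^ m := fun t ht => by
    simp only [hG]
    rw [mul_pow, ← Real.rpow_natCast (t ^ (α - 1)), ← Real.rpow_mul ht.le,
      Nat.cast_sub (by omega), Nat.cast_one]
  have hGm : Measurable G := by
    simp only [hG]; fun_prop
  have hfn : Integrable (fun t => |f t| ^ n) := by
    have := hf.integrable_norm_pow (by omega)
    simpa using this
  have hGn : IntegrableOn (fun t => G t ^ n) (Ioo a b) := by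
    refine ⟨(hGm.pow_const n).aestronglyMeasurable, ?_⟩
    rw [hasFiniteIntegral_iff_enorm]
    simp only [enorm_pow]
    rw [lintegral_deriv_rpow_pow hn hα hc.le ha hab.le]
    exact ENNReal.ofReal_lt_top
  have hGf : IntegrableOn (fun t => G t ^ (n - 1) * f t) (Ioo a b) := by
    refine Integrable.mono' (hGn.add hfn.integrableOn)
      ((hGm.pow_const _).aestronglyMeasurable.mul hf.1.restrict) ?_
    filter_upwards [ae_restrict_mem measurableSet_Ioo] with t ht
    have := hGpos t ht
    rw [Real.norm_eq_abs, abs_mul, abs_of_nonneg (pow_nonneg this _)]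
    exact pow_pred_mul_abs_le hn this
  have hGfn : IntegrableOn (fun t => |G t + f t| ^ n) (Ioo a b) := by
    have h1 : MemLp G n (volume.restrict (Ioo a b)) := by
      refine (integrable_norm_rpow_iff hGm.aestronglyMeasurable ?_ (by simp)).1 ?_
      · simp; omega
      · refine hGn.congr ?_
        filter_upwards [ae_restrict_mem measurableSet_Ioo] with t ht
        simp [abs_of_nonneg (hGpos t ht)]
    have := (h1.add (hf.restrict _)).integrable_norm_pow (by omega)
    simpa [IntegrableOn] using this
  have hwf : IntegrableOn (fun t => t ^ m * f t) (Ioo a b) := by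
    refine (hGf.const_mul ((c * α) ^ (n - 1))⁻¹).congr ?_
    filter_upwards [ae_restrict_mem measurableSet_Ioo] with t ht
    rw [hGw t (ha.trans_lt ht.1)]
    have : (c * α) ^ (n - 1) ≠ 0 := by positivity
    field_simp
  have hsign' : ∀ t ∈ Ioo a b, m * ∫ s in a..t, f s ≤ 0 := fun t ht => by
    have := mul_nonpos_of_nonneg_of_nonpos (by linarith : (0 : ℝ) ≤ n - 1) (hsign t ht)
    rw [hm]; linarith
  have hwf' : IntegrableOn (fun t => t ^ m * f t) (Icc a b) := by
    rwa [integrableOn_Icc_iff_integrableOn_Ioo]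
  -- This is the sign of the first variation. If a = 0 the weight may be singular at the endpoint,
  -- so the inequality on (s, b) is passed to the limit s → 0.
  have key : 0 ≤ ∫ t in a..b, t ^ m * f t := by
    rcases ha.eq_or_lt with rfl | ha'
    · have hcont : ContinuousWithinAt (fun s => ∫ t in s..b, t ^ m * f t) (Ioi 0) 0 := by
        have := intervalIntegral.continuousOn_primitive_interval_left
          (f := fun t => t ^ m * f t) (μ := volume) (a := 0) (b := b) (by rwa [uIcc_of_le hab.le])
        refine ((this 0 (by simp)).mono_of_mem_nhdsWithin ?_)
        rw [uIcc_of_le hab.le]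
        exact mem_of_superset (Ioo_mem_nhdsGT hab) Ioo_subset_Icc_self
      have hlim : Tendsto (fun s : ℝ => |s ^ m * ∫ r in (0:ℝ)..s, f r| ^ n) (𝓝[>] 0) (𝓝 0) := by
        -- The n-th power of the boundary term is at most s^{mn} s^{n-1} ∫|f|^n, and mn + n - 1 =
        -- (n-1)β is positive.
        have hpow : Tendsto (fun s : ℝ => s ^ (((n : ℝ) - 1) * (n * α - n + 1)) * ∫ t, |f t| ^ n)
            (𝓝[>] 0) (𝓝 0) := by
          have h1 : 0 < ((n : ℝ) - 1) * (n * α - n + 1) := mul_pos (by linarith) hβ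
          have := ((Real.continuousAt_rpow_const 0 _ (Or.inr h1.le)).tendsto.mul_const
            (∫ t, |f t| ^ n)).mono_left (nhdsWithin_le_nhds (s := Ioi (0 : ℝ)))
          simpa [Real.zero_rpow h1.ne'] using this
        refine squeeze_zero' (Eventually.of_forall fun s => by positivity) ?_ hpow
        filter_upwards [self_mem_nhdsWithin] with s hs
        have hs0 : (0 : ℝ) < s := hs
        have h1 := abs_integral_pow_le hn hf hs0.le
        rw [sub_zero] at h1
        calc |s ^ m * ∫ r in (0:ℝ)..s, f r| ^ n
            = (s ^ m) ^ n * |∫ r in (0:ℝ)..s, f r| ^ n := by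
              rw [abs_mul, mul_pow, abs_of_pos (by positivity)]
          _ ≤ (s ^ m) ^ n * (s ^ (n - 1) * ∫ t, |f t| ^ n) := by gcongr
          _ = _ := by
              rw [← mul_assoc, ← Real.rpow_natCast (s ^ m), ← Real.rpow_mul hs0.le,
                ← Real.rpow_natCast s, ← Real.rpow_add hs0, Nat.cast_sub (by omega), hm]
              congr 2
              push_cast
              ring
      have hlim0 : Tendsto (fun s : ℝ => -(s ^ m * ∫ r in (0:ℝ)..s, f r)) (𝓝[>] 0) (𝓝 0) := by
        have h1 := hlim.rpow_const (p := 1 / (n : ℝ)) (Or.inr (by positivity))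
        rw [Real.zero_rpow (by positivity)] at h1
        refine squeeze_zero_norm (fun s => le_of_eq ?_) h1
        rw [← Real.rpow_natCast, ← Real.rpow_mul (abs_nonneg _), mul_one_div_cancel hn0.ne',
          Real.rpow_one, norm_neg, Real.norm_eq_abs]
      refine le_of_tendsto_of_tendsto hlim0 hcont.tendsto ?_
      filter_upwards [Ioo_mem_nhdsGT hab] with s hs
      exact neg_rpow_mul_integral_le hs.1 hs.2.le hs.1.le hloc hsign' h0
    · refine le_trans (by simp) (neg_rpow_mul_integral_le ha' hab.le le_rfl hloc hsign' h0)
  have key2 : 0 ≤ ∫ t in Ioo a b, G t ^ (n - 1) * f t := by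
    rw [setIntegral_congr_fun measurableSet_Ioo (g := fun t => (c * α) ^ (n - 1) * (t ^ m * f t))
      (fun t ht => by rw [hGw t (ha.trans_lt ht.1)]; ring), integral_const_mul]
    rw [intervalIntegral.integral_of_le hab.le, integral_Ioc_eq_integral_Ioo] at key
    positivity
  have hle : ∫ t in Ioo a b, G t ^ n ≤ ∫ t in Ioo a b, |G t + f t| ^ n := by
    calc _ ≤ (∫ t in Ioo a b, G t ^ n) + n * ∫ t in Ioo a b, G t ^ (n - 1) * f t := by
          have := mul_nonneg hn0.le key2
          linarith
      _ = ∫ t in Ioo a b, (G t ^ n + n * (G t ^ (n - 1) * f t)) := by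
          rw [integral_add hGn (hGf.const_mul _), integral_const_mul]
      _ ≤ _ := setIntegral_mono_on (hGn.add (hGf.const_mul _)) hGfn measurableSet_Ioo
          fun t ht => pow_add_mul_le_abs_add_pow hn (hGpos t ht)
  have e1 : ∫⁻ t in Ioo a b, ‖G t‖ₑ ^ n = ENNReal.ofReal (∫ t in Ioo a b, G t ^ n) := by
    rw [ofReal_integral_eq_lintegral_ofReal hGn]
    · refine setLIntegral_congr_fun measurableSet_Ioo fun t ht => ?_
      rw [Real.enorm_of_nonneg (hGpos t ht), ENNReal.ofReal_pow (hGpos t ht)]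
    · filter_upwards [ae_restrict_mem measurableSet_Ioo] with t ht
      exact pow_nonneg (hGpos t ht) _
  have e2 : ∫⁻ t in Ioo a b, ‖G t + f t‖ₑ ^ n =
      ENNReal.ofReal (∫ t in Ioo a b, |G t + f t| ^ n) := by
    rw [ofReal_integral_eq_lintegral_ofReal hGfn (ae_of_all _ fun t => by positivity)]
    refine lintegral_congr fun t => ?_
    rw [Real.enorm_eq_ofReal_abs, ENNReal.ofReal_pow (abs_nonneg _)]
  rw [e1, e2]
  exact ENNReal.ofReal_le_ofReal hle

/-! ### From intervals to open subsets of a ray -/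

/-- An inequality between integrals over an open subset of `(0, ∞)` may be checked on the
connected components of that set. -/
lemma setLIntegral_le_of_components {E : Set ℝ} (hE : IsOpen E) (hE0 : E ⊆ Ioi 0)
    {F H : ℝ → ℝ≥0∞} {K : ℝ≥0∞}
    (hb : ∀ a b, 0 ≤ a → a < b → a ∉ E → b ∉ E → ∫⁻ t in Ioo a b, F t ≤ K * ∫⁻ t in Ioo a b, H t)
    (hu : ∀ a, 0 ≤ a → ∫⁻ t in Ioi a, F t ≤ K * ∫⁻ t in Ioi a, H t) :
    ∫⁻ t in E, F t ≤ K * ∫⁻ t in E, H t := by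
  set S : Set (Set ℝ) := (fun x => connectedComponentIn E x) '' E with hS
  have hopen : ∀ I ∈ S, IsOpen I := by
    rintro _ ⟨x, hx, rfl⟩; exact hE.connectedComponentIn
  have hne : ∀ I ∈ S, I.Nonempty := by
    rintro _ ⟨x, hx, rfl⟩; exact ⟨x, mem_connectedComponentIn hx⟩
  have hdisj : S.PairwiseDisjoint id := by
    rintro _ ⟨x, hx, rfl⟩ _ ⟨y, hy, rfl⟩ hne
    refine Set.disjoint_left.2 fun z hz hz' => hne ?_
    simp only [id] at hz hz'
    show connectedComponentIn E x = connectedComponentIn E y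
    rw [connectedComponentIn_eq hz, connectedComponentIn_eq hz']
  have hcount : S.Countable := hdisj.countable_of_isOpen hopen hne
  have hunion : E = ⋃ I ∈ S, I := by
    ext x
    simp only [mem_iUnion]
    constructor
    · exact fun hx => ⟨_, ⟨x, hx, rfl⟩, mem_connectedComponentIn hx⟩
    · rintro ⟨_, ⟨y, hy, rfl⟩, hx⟩
      exact connectedComponentIn_subset _ _ hx
  have hcomp : ∀ I ∈ S, ∫⁻ t in I, F t ≤ K * ∫⁻ t in I, H t := by
    rintro _ ⟨x, hx, rfl⟩
    set I := connectedComponentIn E x with hI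
    have hIo : IsOpen I := hE.connectedComponentIn
    have hxI : x ∈ I := mem_connectedComponentIn hx
    have hIE : I ⊆ E := connectedComponentIn_subset _ _
    have hIc : IsPreconnected I := isPreconnected_connectedComponentIn
    have hbelow : BddBelow I := ⟨0, fun y hy => (hE0 (hIE hy)).le⟩
    have ha0 : 0 ≤ sInf I := le_csInf ⟨x, hxI⟩ fun y hy => (hE0 (hIE hy)).le
    -- Adding a limit point to I keeps it connected, so maximality of the component forces its
    -- endpoints out of E.
    have hmax : ∀ y ∈ E, y ∈ closure I → y ∈ I := fun y hyE hy => by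
      have h1 : IsPreconnected (insert y I) :=
        hIc.subset_closure (subset_insert _ _) (insert_subset hy subset_closure)
      exact h1.subset_connectedComponentIn (mem_insert_of_mem _ hxI)
        (insert_subset hyE hIE) (mem_insert _ _)
    have haI : sInf I ∉ I := fun h => by
      obtain ⟨ε, hε, hball⟩ := Metric.isOpen_iff.1 hIo _ h
      have : sInf I - ε / 2 ∈ I := hball (by simp [abs_of_pos hε]; linarith)
      linarith [csInf_le hbelow this]
    have haE : sInf I ∉ E := fun h => haI (hmax _ h (csInf_mem_closure ⟨x, hxI⟩ hbelow))
    by_cases habove : BddAbove I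
    · have hbI : sSup I ∉ I := fun h => by
        obtain ⟨ε, hε, hball⟩ := Metric.isOpen_iff.1 hIo _ h
        have : sSup I + ε / 2 ∈ I := hball (by simp [abs_of_pos hε]; linarith)
        linarith [le_csSup habove this]
      have hbE : sSup I ∉ E := fun h => hbI (hmax _ h (csSup_mem_closure ⟨x, hxI⟩ habove))
      have hIoo : I = Ioo (sInf I) (sSup I) := by
        refine Subset.antisymm (fun y hy => ?_) (IsConnected.Ioo_csInf_csSup_subset ⟨⟨x, hxI⟩, hIc⟩
          hbelow habove)
        exact ⟨lt_of_le_of_ne (csInf_le hbelow hy) fun h => haI (h ▸ hy),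
          lt_of_le_of_ne (le_csSup habove hy) fun h => hbI (h ▸ hy)⟩
      have hlt : sInf I < sSup I := by
        have := hIoo ▸ hxI
        exact this.1.trans this.2
      have := hb _ _ ha0 hlt haE hbE
      rwa [← hIoo] at this
    · have hIoi : I = Ioi (sInf I) := by
        refine Subset.antisymm (fun y hy => ?_) (IsPreconnected.Ioi_csInf_subset hIc hbelow habove)
        exact lt_of_le_of_ne (csInf_le hbelow hy) fun h => haI (h ▸ hy)
      have := hu _ ha0
      rwa [← hIoi] at this
  rw [hunion, lintegral_biUnion hcount (fun I hI => (hopen I hI).measurableSet) hdisj,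
    lintegral_biUnion hcount (fun I hI => (hopen I hI).measurableSet) hdisj,
    ← ENNReal.tsum_mul_left]
  exact ENNReal.tsum_le_tsum fun I => hcomp I I.2

section OneDim

variable {n : ℕ} {c α : ℝ} {f : ℝ → ℝ}

lemma isOpen_integral_ne_zero (hn : 2 ≤ n) (hf : MemLp f n) :
    IsOpen {t : ℝ | ∫ s in (0 : ℝ)..t, f s ≠ 0} := by
  have hloc : LocallyIntegrable f := hf.locallyIntegrable (by exact_mod_cast (by omega : 1 ≤ n))
  exact isOpen_ne_fun (intervalIntegral.continuous_primitive (fun x y =>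
    (hloc.integrableOn_isCompact isCompact_uIcc).intervalIntegrable) 0) continuous_const

/-- Finite energy of the sum would, after subtracting f in L^n, put the derivative of c t^α in L^n
on a half-line. Hence unbounded components satisfy any comparison trivially, which also settles γ =
∞. -/
lemma lintegral_deriv_rpow_add_Ioi (hn : 2 ≤ n) (hα : 1 - 1 / (n : ℝ) < α) (hc : 0 < c)
    (hf : MemLp f n) {a : ℝ} (ha : 0 ≤ a) :
    ∫⁻ t in Ioi a, ‖c * α * t ^ (α - 1) + f t‖ₑ ^ n = ⊤ := by
  have hGm : Measurable fun t : ℝ => c * α * t ^ (α - 1) := by fun_prop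
  have hn0 : n ≠ 0 := by omega
  have hiff : ∀ {g : ℝ → ℝ} {μ : Measure ℝ}, AEStronglyMeasurable g μ →
      (MemLp g n μ ↔ ∫⁻ t, ‖g t‖ₑ ^ n ∂μ < ⊤) := fun {g μ} hg => by
    have := eLpNorm_lt_top_iff_lintegral_rpow_enorm_lt_top (f := g) (μ := μ) (p := (n : ℝ≥0∞))
      (by simpa using hn0) (by simp)
    simp only [ENNReal.toReal_natCast, ENNReal.rpow_natCast] at this
    rw [← this]
    exact ⟨fun h => h.2, fun h => ⟨hg, h⟩⟩
  by_contra hne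
  have h1 := (hiff (hGm.aestronglyMeasurable.add hf.1.restrict)).2 (lt_top_iff_ne_top.2 hne)
  have h2 := h1.sub (hf.restrict (Ioi a))
  rw [add_sub_cancel_right, hiff hGm.aestronglyMeasurable,
    lintegral_deriv_rpow_pow_Ioi hn hα hc ha] at h2
  exact lt_irrefl _ h2

/-- The primitive of f vanishes at both ends of a bounded component, so f has mean zero there and
the single-interval comparison applies. -/
lemma setLIntegral_deriv_rpow_le (hn : 2 ≤ n) (hα : 1 - 1 / (n : ℝ) < α) (hc : 0 < c) (hf : MemLp f n)
    (h0 : ∀ t ≤ 0, ∫ s in (0 : ℝ)..t, f s = 0) :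
    ∫⁻ t in {t : ℝ | ∫ s in (0 : ℝ)..t, f s ≠ 0}, ‖c * α * t ^ (α - 1)‖ₑ ^ n ≤
      ENNReal.ofReal (logPowerConst n α) *
        ∫⁻ t in {t : ℝ | ∫ s in (0 : ℝ)..t, f s ≠ 0}, ‖c * α * t ^ (α - 1) + f t‖ₑ ^ n := by
  have hloc : LocallyIntegrable f := hf.locallyIntegrable (by exact_mod_cast (by omega : 1 ≤ n))
  have hfi : ∀ x y : ℝ, IntervalIntegrable f volume x y := fun x y =>
    (hloc.integrableOn_isCompact isCompact_uIcc).intervalIntegrable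
  refine setLIntegral_le_of_components (isOpen_integral_ne_zero hn hf)
    (fun t ht => not_le.1 fun h => ht (h0 t h)) (fun a b ha hab haE hbE => ?_) fun a ha => ?_
  · simp only [mem_ofPred_eq, not_not] at haE hbE
    refine lintegral_deriv_rpow_le_of_integral_eq_zero hn hα hc.le ha hab (hfi a b) ?_
    rw [← intervalIntegral.integral_interval_sub_left (hfi 0 b) (hfi 0 a), haE, hbE, sub_zero]
  · rw [lintegral_deriv_rpow_add_Ioi hn hα hc hf ha, ENNReal.mul_top]
    · exact le_top
    · simpa using one_pos.trans_le (one_le_logPowerConst hn hα)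

/-- Since the primitive vanishes at the left end a of a component, the primitives based at 0 and at
a agree, and the sign condition passes to the component. -/
lemma setLIntegral_deriv_rpow_le_of_sign (hn : 2 ≤ n) (hα : 1 - 1 / (n : ℝ) < α) (hc : 0 < c) (hf : MemLp f n)
    (h0 : ∀ t ≤ 0, ∫ s in (0 : ℝ)..t, f s = 0)
    (hsign : ∀ t, (α - 1) * ∫ s in (0 : ℝ)..t, f s ≤ 0) :
    ∫⁻ t in {t : ℝ | ∫ s in (0 : ℝ)..t, f s ≠ 0}, ‖c * α * t ^ (α - 1)‖ₑ ^ n ≤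
        ∫⁻ t in {t : ℝ | ∫ s in (0 : ℝ)..t, f s ≠ 0}, ‖c * α * t ^ (α - 1) + f t‖ₑ ^ n := by
  have hloc : LocallyIntegrable f := hf.locallyIntegrable (by exact_mod_cast (by omega : 1 ≤ n))
  have hfi : ∀ x y : ℝ, IntervalIntegrable f volume x y := fun x y =>
    (hloc.integrableOn_isCompact isCompact_uIcc).intervalIntegrable
  rw [← one_mul (∫⁻ t in _, ‖c * α * t ^ (α - 1) + f t‖ₑ ^ n)]
  refine setLIntegral_le_of_components (isOpen_integral_ne_zero hn hf)
    (fun t ht => not_le.1 fun h => ht (h0 t h)) (fun a b ha hab haE hbE => ?_) fun a ha => ?_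
  · simp only [mem_ofPred_eq, not_not] at haE hbE
    have hshift : ∀ t, ∫ s in a..t, f s = ∫ s in (0 : ℝ)..t, f s := fun t => by
      rw [← intervalIntegral.integral_interval_sub_left (hfi 0 t) (hfi 0 a), haE, sub_zero]
    rw [one_mul]
    exact lintegral_deriv_rpow_le_of_sign hn hα hc ha hab hf
      (fun t _ => by rw [hshift]; exact hsign t) (by rw [hshift, hbE])
  · rw [lintegral_deriv_rpow_add_Ioi hn hα hc hf ha, one_mul]
    exact le_top

end OneDim

/-! ### Behaviour of Sobolev functions along rays -/

lemma isOpen_annulus (n : ℕ) (r₁ r₂ : ℝ≥0∞) : IsOpen (annulus n r₁ r₂) :=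
  (isOpen_lt continuous_const continuous_enorm).inter (isOpen_lt continuous_enorm continuous_const)

lemma enorm_exp_smul {n : ℕ} (t : ℝ) (θ : Metric.sphere (0 : EuclideanSpace ℝ (Fin n)) 1) :
    ‖Real.exp t • (θ : EuclideanSpace ℝ (Fin n))‖ₑ = ENNReal.ofReal (Real.exp t) := by
  rw [enorm_smul, Real.enorm_of_nonneg (Real.exp_pos t).le]
  have : ‖(θ : EuclideanSpace ℝ (Fin n))‖ₑ = 1 := by
    rw [← ofReal_norm]; simp
  rw [this, mul_one]

lemma norm_exp_smul {n : ℕ} (t : ℝ) (θ : Metric.sphere (0 : EuclideanSpace ℝ (Fin n)) 1) :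
    ‖Real.exp t • (θ : EuclideanSpace ℝ (Fin n))‖ = Real.exp t := by
  simp [norm_smul]

lemma exp_smul_mem_annulus {n : ℕ} {γ : ℝ≥0∞} (t : ℝ)
    (θ : Metric.sphere (0 : EuclideanSpace ℝ (Fin n)) 1) :
    Real.exp t • (θ : EuclideanSpace ℝ (Fin n)) ∈ annulus n 1 γ ↔
      0 < t ∧ ENNReal.ofReal (Real.exp t) < γ := by
  simp only [annulus, mem_ofPred_eq, enorm_exp_smul]
  rw [← ENNReal.ofReal_one, ENNReal.ofReal_lt_ofReal_iff (Real.exp_pos t), Real.one_lt_exp_iff]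

/-- A sequence of nonnegative functions whose integrals tend to zero has a subfamily tending to
zero almost everywhere. -/
lemma exists_seq_ae_tendsto_zero {X : Type*} [MeasurableSpace X] {μ : Measure X}
    {G : ℕ → X → ℝ≥0∞} (hG : ∀ k, Measurable (G k))
    (h : Tendsto (fun k => ∫⁻ x, G k x ∂μ) atTop (𝓝 0)) :
    ∃ κ : ℕ → ℕ, ∀ᵐ x ∂μ, Tendsto (fun j => G (κ j) x) atTop (𝓝 0) := by
  -- Integrals below 2^{-j} make the series of the chosen functions integrable, hence finite almost
  -- everywhere, so its terms tend to zero there.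
  have : ∀ j : ℕ, ∃ k, ∫⁻ x, G k x ∂μ < (2⁻¹ : ℝ≥0∞) ^ j := fun j =>
    (h.eventually_lt_const (ENNReal.pow_pos (by simp) j)).exists
  choose κ hκ using this
  refine ⟨κ, ?_⟩
  have hsum : ∫⁻ x, ∑' j, G (κ j) x ∂μ ≠ ⊤ := by
    rw [lintegral_tsum fun j => (hG _).aemeasurable]
    refine ne_top_of_le_ne_top ?_ (ENNReal.tsum_le_tsum fun j => (hκ j).le)
    rw [ENNReal.tsum_geometric]
    simp
  filter_upwards [ae_lt_top (Measurable.tsum fun j => hG _) hsum] with x hx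
  exact ENNReal.tendsto_atTop_zero_of_tsum_ne_top hx.ne

lemma enorm_integral_pow_le {n : ℕ} (hn : 2 ≤ n) {f : ℝ → ℝ} (hf : AEStronglyMeasurable f)
    {a b : ℝ} (hab : a ≤ b) :
    ‖∫ t in a..b, f t‖ₑ ^ n ≤ ENNReal.ofReal (b - a) ^ (n - 1) * ∫⁻ t, ‖f t‖ₑ ^ n := by
  have h1 : ‖∫ t in a..b, f t‖ₑ ≤ ∫⁻ t in Ioc a b, ‖f t‖ₑ := by
    rw [intervalIntegral.integral_of_le hab]
    exact enorm_integral_le_lintegral_enorm _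
  refine ((pow_le_pow_left₀ zero_le h1 n).trans
    (lintegral_pow_le_measure_mul hn hf.aemeasurable.enorm.restrict)).trans ?_
  simp only [Measure.restrict_apply_univ, Real.volume_Ioc]
  gcongr
  exact Measure.restrict_le_self

lemma memLp_natCast_iff {X E : Type*} [MeasurableSpace X] [NormedAddCommGroup E] {μ : Measure X}
    {n : ℕ} (hn : n ≠ 0) {g : X → E} (hg : AEStronglyMeasurable g μ) :
    MemLp g n μ ↔ ∫⁻ x, ‖g x‖ₑ ^ n ∂μ < ⊤ := by
  have := eLpNorm_lt_top_iff_lintegral_rpow_enorm_lt_top (f := g) (μ := μ) (p := (n : ℝ≥0∞))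
    (by simpa using hn) (by simp)
  simp only [ENNReal.toReal_natCast, ENNReal.rpow_natCast] at this
  rw [← this]
  exact ⟨fun h => h.2, fun h => ⟨hg, h⟩⟩

lemma eLpNorm_natCast_pow {X E : Type*} [MeasurableSpace X] [NormedAddCommGroup E] {μ : Measure X}
    {n : ℕ} (hn : n ≠ 0) (g : X → E) :
    eLpNorm g n μ ^ n = ∫⁻ x, ‖g x‖ₑ ^ n ∂μ := by
  rw [eLpNorm_eq_lintegral_rpow_enorm_toReal (by simpa using hn) (by simp)]
  simp only [ENNReal.toReal_natCast, ENNReal.rpow_natCast]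
  rw [← ENNReal.rpow_natCast, ← ENNReal.rpow_mul, one_div_mul_cancel (by exact_mod_cast hn),
    ENNReal.rpow_one]

/-- Cauchy–Schwarz: the derivative in t along a ray is controlled by e^t times the full gradient.
Discarding the tangential part here is the only loss in the reduction to rays. -/
lemma enorm_exp_mul_inner_pow_le {n : ℕ} (v : EuclideanSpace ℝ (Fin n)) (t : ℝ)
    (θ : Metric.sphere (0 : EuclideanSpace ℝ (Fin n)) 1) :
    ‖inner ℝ v (Real.exp t • (θ : EuclideanSpace ℝ (Fin n)))‖ₑ ^ n ≤
      ENNReal.ofReal (Real.exp t) ^ n * ‖v‖ₑ ^ n := by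
  rw [← mul_pow]
  gcongr
  rw [mul_comm, ← enorm_exp_smul t θ]
  rw [← ofReal_norm, ← ofReal_norm, ← ofReal_norm,
    ← ENNReal.ofReal_mul (norm_nonneg _)]
  exact ENNReal.ofReal_le_ofReal (norm_inner_le_norm _ _)

/-- The absolute continuity on almost every ray of functions in `W^{1,n}_0` of an annulus. -/
theorem ae_ray_eq_integral {n : ℕ} (hn : 2 ≤ n) {γ : ℝ≥0∞} {φ : EuclideanSpace ℝ (Fin n) → ℝ}
    {h : EuclideanSpace ℝ (Fin n) → EuclideanSpace ℝ (Fin n)} (hφm : Measurable φ)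
    (hhm : Measurable h)
    (hh0 : ∀ x ∉ annulus n 1 γ, h x = 0)
    (hhn : ∫⁻ x, ‖h x‖ₑ ^ n ≠ ⊤)
    {ψ : ℕ → EuclideanSpace ℝ (Fin n) → ℝ} (hψ : ∀ k, IsTestFunction (annulus n 1 γ) (ψ k))
    (hψφ : Tendsto (fun k => ∫⁻ x, ‖ψ k x - φ x‖ₑ ^ n) atTop (𝓝 0))
    (hψh : Tendsto (fun k => ∫⁻ x, ‖∇ (ψ k) x - h x‖ₑ ^ n) atTop (𝓝 0)) :
    ∀ᵐ θ : Metric.sphere (0 : EuclideanSpace ℝ (Fin n)) 1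
      ∂(volume : Measure (EuclideanSpace ℝ (Fin n))).toSphere,
      MemLp (fun t : ℝ => inner ℝ (h (Real.exp t • (θ : EuclideanSpace ℝ (Fin n))))
        (Real.exp t • (θ : EuclideanSpace ℝ (Fin n)))) n ∧
      (∀ t ≤ 0, ∫ s in (0 : ℝ)..t, inner ℝ (h (Real.exp s • (θ : EuclideanSpace ℝ (Fin n))))
        (Real.exp s • (θ : EuclideanSpace ℝ (Fin n))) = 0) ∧
      ∀ᵐ t : ℝ, φ (Real.exp t • (θ : EuclideanSpace ℝ (Fin n))) =
        ∫ s in (0 : ℝ)..t, inner ℝ (h (Real.exp s • (θ : EuclideanSpace ℝ (Fin n))))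
        (Real.exp s • (θ : EuclideanSpace ℝ (Fin n))) := by
  have hn0 : n ≠ 0 := by omega
  have hgm : ∀ k, Continuous (∇ (ψ k)) := fun k => by
    have h1 := (hψ k).1.continuous_fderiv (by simp)
    exact (InnerProductSpace.toDual ℝ (EuclideanSpace ℝ (Fin n))).symm.continuous.comp h1
  have hψm : ∀ k, Continuous (ψ k) := fun k => (hψ k).1.continuous
  have hF1 : ∀ k, Measurable fun x => ‖ψ k x - φ x‖ₑ ^ n := fun k =>
    (((hψm k).measurable.sub hφm).enorm).pow_const n
  have hF2 : ∀ k, Measurable fun x => ‖∇ (ψ k) x - h x‖ₑ ^ n := fun k =>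
    (((hgm k).measurable.sub hhm).enorm).pow_const n
  have hF3 : Measurable fun x => ‖h x‖ₑ ^ n := hhm.enorm.pow_const n
  have hpol : ∀ {F : EuclideanSpace ℝ (Fin n) → ℝ≥0∞}, Measurable F →
      Measurable fun p : Metric.sphere (0 : EuclideanSpace ℝ (Fin n)) 1 × ℝ =>
        ENNReal.ofReal (Real.exp p.2) ^ n *
          F (Real.exp p.2 • (p.1 : EuclideanSpace ℝ (Fin n))) := fun {F} hF => by
    have h2 : Measurable fun p : Metric.sphere (0 : EuclideanSpace ℝ (Fin n)) 1 × ℝ =>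
        F (Real.exp p.2 • (p.1 : EuclideanSpace ℝ (Fin n))) := hF.comp (by fun_prop)
    fun_prop
  have hpolm : ∀ {F : EuclideanSpace ℝ (Fin n) → ℝ≥0∞}, Measurable F →
      Measurable fun θ : Metric.sphere (0 : EuclideanSpace ℝ (Fin n)) 1 =>
        ∫⁻ t : ℝ, ENNReal.ofReal (Real.exp t) ^ n *
          F (Real.exp t • (θ : EuclideanSpace ℝ (Fin n))) := fun {F} hF =>
    (hpol hF).lintegral_prod_right'
  -- The errors of the functions and of the gradients are added, so that one sequence `κ` serves
  -- both on almost every ray.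
  have hsum : Tendsto (fun k => ∫⁻ x, (‖ψ k x - φ x‖ₑ ^ n + ‖∇ (ψ k) x - h x‖ₑ ^ n))
      atTop (𝓝 0) := by
    rw [← add_zero (0 : ℝ≥0∞)]
    exact (hψφ.add hψh).congr fun k => (lintegral_add_left (hF1 k) _).symm
  replace hsum := hsum.congr fun k =>
    lintegral_logPolar (by omega : 1 ≤ n) ((hF1 k).add (hF2 k))
  obtain ⟨κ, hκ⟩ := exists_seq_ae_tendsto_zero (fun k => hpolm ((hF1 k).add (hF2 k))) hsum
  rw [lintegral_logPolar (by omega : 1 ≤ n) hF3] at hhn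
  filter_upwards [hκ, ae_lt_top (hpolm hF3) hhn] with θ hθ hθh
  set f : ℝ → ℝ := fun t => inner ℝ (h (Real.exp t • (θ : EuclideanSpace ℝ (Fin n))))
        (Real.exp t • (θ : EuclideanSpace ℝ (Fin n))) with hf
  have hray : Measurable fun t : ℝ => Real.exp t • (θ : EuclideanSpace ℝ (Fin n)) := by fun_prop
  have hrayc : Continuous fun t : ℝ => Real.exp t • (θ : EuclideanSpace ℝ (Fin n)) := by fun_prop
  have hfm : Measurable f := (hhm.comp hray).inner hray
  have hfL : MemLp f n := by
    rw [memLp_natCast_iff hn0 hfm.aestronglyMeasurable]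
    exact (lintegral_mono fun t => enorm_exp_mul_inner_pow_le _ t θ).trans_lt hθh
  have hnot : ∀ t ≤ 0, Real.exp t • (θ : EuclideanSpace ℝ (Fin n)) ∉ annulus n 1 γ :=
    fun t ht hmem => absurd ((exp_smul_mem_annulus t θ).1 hmem).1 (not_lt.2 ht)
  have hf0 : ∀ t ≤ 0, f t = 0 := fun t ht => by
    simp only [hf, hh0 _ (hnot t ht), inner_zero_left]
  have hloc : LocallyIntegrable f := hfL.locallyIntegrable (by exact_mod_cast (by omega : 1 ≤ n))
  have hfi : ∀ x y : ℝ, IntervalIntegrable f volume x y := fun x y =>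
    (hloc.integrableOn_isCompact isCompact_uIcc).intervalIntegrable
  have hI0 : ∀ t ≤ 0, ∫ s in (0 : ℝ)..t, f s = 0 := fun t ht => by
    rw [intervalIntegral.integral_zero_ae]
    refine Eventually.of_forall fun s hs => hf0 s ?_
    rw [uIoc_of_ge ht] at hs
    exact hs.2
  refine ⟨hfL, hI0, ?_⟩
  have hlim1 : Tendsto (fun j => ∫⁻ t : ℝ, ENNReal.ofReal (Real.exp t) ^ n *
      ‖ψ (κ j) (Real.exp t • (θ : EuclideanSpace ℝ (Fin n))) -
        φ (Real.exp t • (θ : EuclideanSpace ℝ (Fin n)))‖ₑ ^ n) atTop (𝓝 0) :=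
    tendsto_of_tendsto_of_tendsto_of_le_of_le tendsto_const_nhds hθ (fun _ => zero_le)
      fun j => lintegral_mono fun t => mul_le_mul_right (le_self_add (α := ℝ≥0∞)) _
  have hlim2 : Tendsto (fun j => ∫⁻ t : ℝ, ENNReal.ofReal (Real.exp t) ^ n *
      ‖∇ (ψ (κ j)) (Real.exp t • (θ : EuclideanSpace ℝ (Fin n))) -
        h (Real.exp t • (θ : EuclideanSpace ℝ (Fin n)))‖ₑ ^ n) atTop (𝓝 0) :=
    tendsto_of_tendsto_of_tendsto_of_le_of_le tendsto_const_nhds hθ (fun _ => zero_le)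
      fun j => lintegral_mono fun t => mul_le_mul_right (le_add_self (α := ℝ≥0∞)) _
  -- Convergence holds at every t, not only almost everywhere: each ψ vanishes at t = 0, so it is
  -- the integral of its radial derivative, and Hölder's inequality on (0, t) bounds the difference
  -- of the primitives.
  have hpt : ∀ t : ℝ, Tendsto (fun j => ψ (κ j) (Real.exp t • (θ : EuclideanSpace ℝ (Fin n))))
      atTop (𝓝 (∫ s in (0 : ℝ)..t, f s)) := fun t => by
    have hψ0 : ∀ k, ∀ t ≤ 0, ψ k (Real.exp t • (θ : EuclideanSpace ℝ (Fin n))) = 0 :=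
      fun k t ht => image_eq_zero_of_notMem_tsupport fun hmem => hnot t ht ((hψ k).2.2 hmem)
    rcases le_total t 0 with ht | ht
    · simp only [hψ0 _ t ht, hI0 t ht, tendsto_const_nhds]
    set d : ℕ → ℝ → ℝ := fun k s => inner ℝ
      (∇ (ψ k) (Real.exp s • (θ : EuclideanSpace ℝ (Fin n))))
      (Real.exp s • (θ : EuclideanSpace ℝ (Fin n))) with hd
    have hdc : ∀ k, Continuous (d k) := fun k => ((hgm k).comp hrayc).inner hrayc
    have hder : ∀ k s, HasDerivAt
        (fun s : ℝ => ψ k (Real.exp s • (θ : EuclideanSpace ℝ (Fin n)))) (d k s) s := fun k s => by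
      have h1 : HasGradientAt (ψ k) (∇ (ψ k) (Real.exp s • (θ : EuclideanSpace ℝ (Fin n))))
          (Real.exp s • (θ : EuclideanSpace ℝ (Fin n))) :=
        ((hψ k).1.differentiable (by simp) _).hasGradientAt
      have h2 : HasDerivAt (fun s : ℝ => Real.exp s • (θ : EuclideanSpace ℝ (Fin n)))
          (Real.exp s • (θ : EuclideanSpace ℝ (Fin n))) s := (Real.hasDerivAt_exp s).smul_const _
      have h3 := h1.hasFDerivAt.comp_hasDerivAt s h2
      have h4 : ∀ v, inner ℝ (∇ (ψ k) (Real.exp s • (θ : EuclideanSpace ℝ (Fin n)))) v =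
          (InnerProductSpace.toDual ℝ (EuclideanSpace ℝ (Fin n)))
            (∇ (ψ k) (Real.exp s • (θ : EuclideanSpace ℝ (Fin n)))) v := fun v => rfl
      simp only [hd, h4]
      exact h3
    have hFTC : ∀ k, ψ k (Real.exp t • (θ : EuclideanSpace ℝ (Fin n))) =
        ∫ s in (0 : ℝ)..t, d k s := fun k => by
      rw [intervalIntegral.integral_eq_sub_of_hasDerivAt (fun s _ => hder k s)
        ((hdc k).intervalIntegrable _ _), hψ0 k 0 le_rfl, sub_zero]
    have hsub : ∀ k, ‖ψ k (Real.exp t • (θ : EuclideanSpace ℝ (Fin n))) -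
        ∫ s in (0 : ℝ)..t, f s‖ₑ ^ n ≤ ENNReal.ofReal (t - 0) ^ (n - 1) *
          ∫⁻ t : ℝ, ENNReal.ofReal (Real.exp t) ^ n *
      ‖∇ (ψ k) (Real.exp t • (θ : EuclideanSpace ℝ (Fin n))) -
        h (Real.exp t • (θ : EuclideanSpace ℝ (Fin n)))‖ₑ ^ n := fun k => by
      rw [hFTC k, ← intervalIntegral.integral_sub ((hdc k).intervalIntegrable _ _) (hfi _ _)]
      refine (enorm_integral_pow_le hn ((hdc k).measurable.sub hfm).aestronglyMeasurable ht).trans ?_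
      gcongr with s
      rw [Pi.sub_apply]
      simp only [hd, hf]
      rw [← inner_sub_left]
      exact enorm_exp_mul_inner_pow_le _ s θ
    have hz : Tendsto (fun j => ‖ψ (κ j) (Real.exp t • (θ : EuclideanSpace ℝ (Fin n))) -
        ∫ s in (0 : ℝ)..t, f s‖ₑ ^ n) atTop (𝓝 0) := by
      refine tendsto_of_tendsto_of_tendsto_of_le_of_le tendsto_const_nhds ?_ (fun _ => zero_le)
        fun j => hsub (κ j)
      have := ENNReal.Tendsto.const_mul (a := ENNReal.ofReal (t - 0) ^ (n - 1)) hlim2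
        (Or.inr (by simp))
      simpa using this
    have hz2 := (ENNReal.continuous_rpow_const (y := 1 / (n : ℝ))).tendsto 0 |>.comp hz
    rw [ENNReal.zero_rpow_of_pos (by positivity)] at hz2
    rw [tendsto_iff_edist_tendsto_0]
    refine hz2.congr fun j => ?_
    simp only [Function.comp]
    rw [← ENNReal.rpow_natCast, ← ENNReal.rpow_mul, mul_one_div_cancel (by exact_mod_cast hn0),
      ENNReal.rpow_one, edist_eq_enorm_sub]
  have hFc : Continuous fun t => ∫ s in (0 : ℝ)..t, f s :=
    intervalIntegral.continuous_primitive hfi 0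
  -- Fatou's lemma identifies the pointwise limit just found with the limit φ in the weighted L^n
  -- norm on the ray.
  have hfatou : ∫⁻ t : ℝ, ENNReal.ofReal (Real.exp t) ^ n * ‖(∫ s in (0 : ℝ)..t, f s) -
        φ (Real.exp t • (θ : EuclideanSpace ℝ (Fin n)))‖ₑ ^ n = 0 := by
    refine le_antisymm ?_ zero_le
    have hle := lintegral_liminf_le (u := atTop) (μ := volume) (f := fun j (t : ℝ) =>
      ENNReal.ofReal (Real.exp t) ^ n *
      ‖ψ (κ j) (Real.exp t • (θ : EuclideanSpace ℝ (Fin n))) -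
        φ (Real.exp t • (θ : EuclideanSpace ℝ (Fin n)))‖ₑ ^ n) (fun j => by
        have h1 := (hF1 (κ j)).comp hray
        simp only [Function.comp_def] at h1
        fun_prop)
    rw [hlim1.liminf_eq] at hle
    refine le_trans (le_of_eq (lintegral_congr fun t => ?_)) hle
    refine (Tendsto.liminf_eq ?_).symm
    refine ENNReal.Tendsto.const_mul ?_ (Or.inr (by simp))
    exact ((ENNReal.continuous_pow n).tendsto _).comp ((hpt t).sub_const _).enorm
  have hmeas : Measurable fun t : ℝ => ENNReal.ofReal (Real.exp t) ^ n * ‖(∫ s in (0 : ℝ)..t, f s) -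
        φ (Real.exp t • (θ : EuclideanSpace ℝ (Fin n)))‖ₑ ^ n := by
    have h1 := ((hFc.measurable.sub (hφm.comp hray)).enorm).pow_const n
    simp only [Function.comp_def] at h1
    exact (by fun_prop : Measurable fun t : ℝ => ENNReal.ofReal (Real.exp t) ^ n).mul h1
  rw [lintegral_eq_zero_iff hmeas] at hfatou
  filter_upwards [hfatou] with t ht
  simp [hn0, not_le.2 (Real.exp_pos t)] at ht
  linarith

/-! ### Reduction of the energy comparison to rays -/

/-- The gradient of `x ↦ c * (log |x|) ^ α`. -/
noncomputable def logPowerGrad (n : ℕ) (c α : ℝ) (x : EuclideanSpace ℝ (Fin n)) :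
    EuclideanSpace ℝ (Fin n) :=
  (c * α * Real.log ‖x‖ ^ (α - 1) / ‖x‖ ^ 2) • x

lemma measurable_logPowerGrad (n : ℕ) (c α : ℝ) : Measurable (logPowerGrad n c α) := by
  unfold logPowerGrad
  have : Measurable fun x : EuclideanSpace ℝ (Fin n) => ‖x‖ := measurable_norm
  fun_prop

/-- Conformal invariance: for a radial gradient of length |d|/|x| the weight e^{mt} cancels, leaving
the one-dimensional energy density. The factor c allows for u, for -u (c = -1) and, with α = 1, for
multiples of log|x|. -/
lemma exp_pow_mul_enorm_logPowerGrad {n m : ℕ} (c α t : ℝ)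
    (θ : Metric.sphere (0 : EuclideanSpace ℝ (Fin n)) 1) :
    ENNReal.ofReal (Real.exp t) ^ m *
      ‖logPowerGrad n c α (Real.exp t • (θ : EuclideanSpace ℝ (Fin n)))‖ₑ ^ m =
        ‖c * α * t ^ (α - 1)‖ₑ ^ m := by
  have he := Real.exp_pos t
  rw [← mul_pow, logPowerGrad, norm_exp_smul, enorm_smul, enorm_exp_smul, Real.log_exp,
    ← Real.enorm_of_nonneg he.le, ← enorm_mul, ← enorm_mul]
  congr 2
  field_simp

lemma inner_logPowerGrad {n : ℕ} (c α t : ℝ)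
    (θ : Metric.sphere (0 : EuclideanSpace ℝ (Fin n)) 1) :
    inner ℝ (logPowerGrad n c α (Real.exp t • (θ : EuclideanSpace ℝ (Fin n))))
      (Real.exp t • (θ : EuclideanSpace ℝ (Fin n))) = c * α * t ^ (α - 1) := by
  have he := Real.exp_pos t
  rw [logPowerGrad, norm_exp_smul, inner_smul_left, real_inner_self_eq_norm_sq, norm_exp_smul,
    Real.log_exp]
  simp only [conj_trivial]
  field_simp

lemma energy_natCast {n : ℕ} (S : Set (EuclideanSpace ℝ (Fin n)))
    (g : EuclideanSpace ℝ (Fin n) → EuclideanSpace ℝ (Fin n)) :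
    energy n S g = ∫⁻ x in S, ‖g x‖ₑ ^ n := by
  simp only [energy, ENNReal.rpow_natCast]

lemma energy_congr {n : ℕ} {p : ℝ} {Ω S S' : Set (EuclideanSpace ℝ (Fin n))}
    {g g' : EuclideanSpace ℝ (Fin n) → EuclideanSpace ℝ (Fin n)} (hSΩ : S ⊆ Ω)
    (hS : S =ᵐ[volume] S') (hg : g =ᵐ[volume.restrict Ω] g') :
    energy p S g = energy p S' g' := by
  rw [energy, energy, ← Measure.restrict_congr_set hS]
  refine lintegral_congr_ae ?_
  filter_upwards [ae_mono (Measure.restrict_mono hSΩ le_rfl) hg] with x hx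
  rw [hx]

/-- The energy on a set, in logarithmic polar coordinates. -/
lemma energy_eq_lintegral_logPolar {n : ℕ} (hn : 1 ≤ n) {S : Set (EuclideanSpace ℝ (Fin n))}
    (hS : MeasurableSet S) {g : EuclideanSpace ℝ (Fin n) → EuclideanSpace ℝ (Fin n)}
    (hg : Measurable g) :
    energy n S g = ∫⁻ θ : Metric.sphere (0 : EuclideanSpace ℝ (Fin n)) 1,
      (∫⁻ t in {t : ℝ | Real.exp t • (θ : EuclideanSpace ℝ (Fin n)) ∈ S},
        ENNReal.ofReal (Real.exp t) ^ n *
          ‖g (Real.exp t • (θ : EuclideanSpace ℝ (Fin n)))‖ₑ ^ n)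
      ∂(volume : Measure (EuclideanSpace ℝ (Fin n))).toSphere := by
  have hgm : Measurable fun x => ‖g x‖ₑ ^ n := hg.enorm.pow_const n
  rw [energy_natCast, ← lintegral_indicator hS, lintegral_logPolar hn (hgm.indicator hS)]
  refine lintegral_congr fun θ => ?_
  have hray : Measurable fun t : ℝ => Real.exp t • (θ : EuclideanSpace ℝ (Fin n)) := by fun_prop
  have hSray : MeasurableSet {t : ℝ | Real.exp t • (θ : EuclideanSpace ℝ (Fin n)) ∈ S} := hray hS
  rw [← lintegral_indicator hSray]
  refine lintegral_congr fun t => ?_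
  by_cases ht : Real.exp t • (θ : EuclideanSpace ℝ (Fin n)) ∈ S
  · rw [indicator_of_mem ht, indicator_of_mem (by exact ht)]
  · rw [indicator_of_notMem ht, indicator_of_notMem (by exact ht), mul_zero]

/-- Functions in `W^{1,n}_0` of an annulus have a good representative, absolutely continuous along
almost every ray. -/
theorem MemSobolevZero.exists_representative {n : ℕ} (hn : 2 ≤ n) {γ : ℝ≥0∞}
    {φ : EuclideanSpace ℝ (Fin n) → ℝ}
    {h : EuclideanSpace ℝ (Fin n) → EuclideanSpace ℝ (Fin n)}
    (hφ : MemSobolevZero n (annulus n 1 γ) φ h) :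
    ∃ φ' h', Measurable φ' ∧ Measurable h' ∧ φ =ᵐ[volume.restrict (annulus n 1 γ)] φ' ∧
      h =ᵐ[volume.restrict (annulus n 1 γ)] h' ∧ (∀ x ∉ annulus n 1 γ, φ' x = 0) ∧
      ∀ᵐ θ : Metric.sphere (0 : EuclideanSpace ℝ (Fin n)) 1
      ∂(volume : Measure (EuclideanSpace ℝ (Fin n))).toSphere,
      MemLp (fun t : ℝ => inner ℝ (h' (Real.exp t • (θ : EuclideanSpace ℝ (Fin n))))
        (Real.exp t • (θ : EuclideanSpace ℝ (Fin n)))) n ∧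
      (∀ t ≤ 0, ∫ s in (0 : ℝ)..t, inner ℝ (h' (Real.exp s • (θ : EuclideanSpace ℝ (Fin n))))
        (Real.exp s • (θ : EuclideanSpace ℝ (Fin n))) = 0) ∧
      ∀ᵐ t : ℝ, φ' (Real.exp t • (θ : EuclideanSpace ℝ (Fin n))) =
        ∫ s in (0 : ℝ)..t, inner ℝ (h' (Real.exp s • (θ : EuclideanSpace ℝ (Fin n))))
        (Real.exp s • (θ : EuclideanSpace ℝ (Fin n))) := by
  obtain ⟨⟨-, hφp, hhp⟩, ψ, hψ, hψφ, hψh⟩ := hφ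
  rw [ENNReal.ofReal_natCast] at hφp hhp hψφ hψh
  have hn0 : n ≠ 0 := by omega
  set Ω := annulus n 1 γ with hΩ
  have hΩm : MeasurableSet Ω := (isOpen_annulus n 1 γ).measurableSet
  -- Measurable representatives, extended by zero, let integrals over the annulus be treated as
  -- integrals over the whole space.
  set φ' := Ω.indicator (hφp.1.mk φ) with hφ'
  set h' := Ω.indicator (hhp.1.mk h) with hh'
  have eφ : φ =ᵐ[volume.restrict Ω] φ' := by
    filter_upwards [hφp.1.ae_eq_mk, ae_restrict_mem hΩm] with x hx hxΩ
    rw [hφ', indicator_of_mem hxΩ, hx]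
  have eh : h =ᵐ[volume.restrict Ω] h' := by
    filter_upwards [hhp.1.ae_eq_mk, ae_restrict_mem hΩm] with x hx hxΩ
    rw [hh', indicator_of_mem hxΩ, hx]
  have mφ : Measurable φ' := hφp.1.stronglyMeasurable_mk.measurable.indicator hΩm
  have mh : Measurable h' := hhp.1.stronglyMeasurable_mk.measurable.indicator hΩm
  have zφ : ∀ x ∉ Ω, φ' x = 0 := fun x hx => indicator_of_notMem hx _
  have zh : ∀ x ∉ Ω, h' x = 0 := fun x hx => indicator_of_notMem hx _
  have hglob : ∀ {E : Type} [NormedAddCommGroup E] (F : EuclideanSpace ℝ (Fin n) → E),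
      (∀ x ∉ Ω, F x = 0) → ∫⁻ x, ‖F x‖ₑ ^ n = ∫⁻ x in Ω, ‖F x‖ₑ ^ n := fun F hF =>
    (setLIntegral_eq_of_support_subset fun x hx => by
      by_contra hxΩ
      exact hx (by simp [hF x hxΩ, hn0])).symm
  have hlim : ∀ {E : Type} [NormedAddCommGroup E] {F F' : ℕ → EuclideanSpace ℝ (Fin n) → E},
      (∀ k, ∀ x ∉ Ω, F' k x = 0) → (∀ k, F k =ᵐ[volume.restrict Ω] F' k) →
      Tendsto (fun k => eLpNorm (F k) n (volume.restrict Ω)) atTop (𝓝 0) →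
      Tendsto (fun k => ∫⁻ x, ‖F' k x‖ₑ ^ n) atTop (𝓝 0) := fun {E} _ {F F'} hz he ht => by
    have h1 := (ENNReal.continuous_pow n).tendsto 0 |>.comp ht
    rw [zero_pow hn0] at h1
    refine h1.congr fun k => ?_
    simp only [Function.comp]
    rw [eLpNorm_congr_ae (he k), eLpNorm_natCast_pow hn0, hglob _ (hz k)]
  have hψz : ∀ k, ∀ x ∉ Ω, ψ k x = 0 := fun k x hx =>
    image_eq_zero_of_notMem_tsupport fun hmem => hx ((hψ k).2.2 hmem)
  have hψz' : ∀ k, ∀ x ∉ Ω, ∇ (ψ k) x = 0 := fun k x hx => by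
    have : fderiv ℝ (ψ k) x = 0 :=
      image_eq_zero_of_notMem_tsupport fun hmem => hx ((hψ k).2.2 (tsupport_fderiv_subset ℝ hmem))
    simp [gradient, this]
  refine ⟨φ', h', mφ, mh, eφ, eh, zφ, ae_ray_eq_integral hn mφ mh zh ?_ hψ
    (hlim (fun k x hx => by rw [hψz k x hx, zφ x hx, sub_zero]) (fun k => ?_) hψφ)
    (hlim (fun k x hx => by rw [hψz' k x hx, zh x hx, sub_zero]) (fun k => ?_) hψh)⟩
  · rw [hglob _ zh]
    exact ((memLp_natCast_iff hn0 mh.aestronglyMeasurable).1 (hhp.ae_eq eh)).ne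
  · filter_upwards [eφ] with x hx
    rw [hx]
  · filter_upwards [eh] with x hx
    rw [hx]

/-- Reduction of the energy comparison on an annulus to a one-dimensional comparison on rays. -/
theorem energy_logPowerGrad_le {n : ℕ} (hn : 2 ≤ n) {γ : ℝ≥0∞} {c α : ℝ} {K : ℝ≥0∞} (hK : K ≠ ⊤)
    {φ : EuclideanSpace ℝ (Fin n) → ℝ}
    {h : EuclideanSpace ℝ (Fin n) → EuclideanSpace ℝ (Fin n)}
    (hφ : MemSobolevZero n (annulus n 1 γ) φ h) (P : ℝ → Prop)
    (hP : ∀ᵐ x ∂(volume.restrict (annulus n 1 γ)), P (φ x)) (hP0 : P 0)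
    (hPc : IsClosed {y | P y})
    (hray : ∀ f : ℝ → ℝ, MemLp f n → (∀ t ≤ 0, ∫ s in (0 : ℝ)..t, f s = 0) →
      (∀ t, P (∫ s in (0 : ℝ)..t, f s)) →
      ∫⁻ t in {t : ℝ | ∫ s in (0 : ℝ)..t, f s ≠ 0}, ‖c * α * t ^ (α - 1)‖ₑ ^ n ≤
        K * ∫⁻ t in {t : ℝ | ∫ s in (0 : ℝ)..t, f s ≠ 0}, ‖c * α * t ^ (α - 1) + f t‖ₑ ^ n) :
    energy n {x ∈ annulus n 1 γ | φ x ≠ 0} (logPowerGrad n c α) ≤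
      K * energy n {x ∈ annulus n 1 γ | φ x ≠ 0} (logPowerGrad n c α + h) := by
  obtain ⟨φ', h', mφ, mh, eφ, eh, zφ, hrep⟩ := hφ.exists_representative hn
  have hΩm : MeasurableSet (annulus n 1 γ) := (isOpen_annulus n 1 γ).measurableSet
  have hS : {x ∈ annulus n 1 γ | φ x ≠ 0} =ᵐ[volume] {x | φ' x ≠ 0} := by
    rw [eventuallyEq_set]
    filter_upwards [(ae_restrict_iff' hΩm).1 eφ] with x hx
    by_cases hxΩ : x ∈ annulus n 1 γ
    · simp [hxΩ, hx hxΩ]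
    · simp [hxΩ, zφ x hxΩ]
  have hSm : MeasurableSet {x | φ' x ≠ 0} := mφ (measurableSet_singleton 0).compl
  have hgm := measurable_logPowerGrad n c α
  rw [energy_congr (sep_subset _ _) hS (EventuallyEq.refl _ _),
    energy_congr (g' := logPowerGrad n c α + h') (sep_subset _ _) hS
      ((EventuallyEq.refl _ _).add eh),
    energy_eq_lintegral_logPolar (by omega) hSm hgm,
    energy_eq_lintegral_logPolar (by omega) hSm (hgm.add mh)]
  -- The property `P` encodes the sign restriction on φ; it must be carried from almost every point
  -- of the annulus to every point of almost every ray.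
  have hPall : ∀ᵐ x, P (φ' x) := by
    have := (ae_restrict_iff' hΩm).1 (hP.and eφ)
    filter_upwards [this] with x hx
    by_cases hxΩ : x ∈ annulus n 1 γ
    · rw [← (hx hxΩ).2]; exact (hx hxΩ).1
    · rw [zφ x hxΩ]; exact hP0
  have hPm : MeasurableSet {x | ¬ P (φ' x)} := mφ hPc.measurableSet.compl
  have hPray : ∀ᵐ θ : Metric.sphere (0 : EuclideanSpace ℝ (Fin n)) 1
      ∂(volume : Measure (EuclideanSpace ℝ (Fin n))).toSphere,
      ∀ᵐ t : ℝ, P (φ' (Real.exp t • (θ : EuclideanSpace ℝ (Fin n)))) := by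
    -- Polar coordinates applied to the indicator of a null set show that almost every ray meets it
    -- in a null set.
    have h1 : ∫⁻ x, {x | ¬ P (φ' x)}.indicator 1 x = 0 := by
      rw [lintegral_indicator_one hPm]
      exact hPall
    have hm1 : Measurable ({x | ¬ P (φ' x)}.indicator (1 : EuclideanSpace ℝ (Fin n) → ℝ≥0∞)) :=
      measurable_one.indicator hPm
    have hm2 : Measurable fun p : Metric.sphere (0 : EuclideanSpace ℝ (Fin n)) 1 × ℝ =>
        ENNReal.ofReal (Real.exp p.2) ^ n * {x | ¬ P (φ' x)}.indicator
          (1 : EuclideanSpace ℝ (Fin n) → ℝ≥0∞)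
          (Real.exp p.2 • (p.1 : EuclideanSpace ℝ (Fin n))) := by
      have h2 := hm1.comp (by fun_prop : Measurable
        fun p : Metric.sphere (0 : EuclideanSpace ℝ (Fin n)) 1 × ℝ =>
          Real.exp p.2 • (p.1 : EuclideanSpace ℝ (Fin n)))
      exact (by fun_prop : Measurable fun p : Metric.sphere (0 : EuclideanSpace ℝ (Fin n)) 1 × ℝ =>
        ENNReal.ofReal (Real.exp p.2) ^ n).mul h2
    rw [lintegral_logPolar (by omega) hm1, lintegral_eq_zero_iff hm2.lintegral_prod_right'] at h1
    filter_upwards [h1] with θ hθ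
    simp only [Pi.zero_apply] at hθ
    have hm3 := hm2.comp (measurable_prodMk_left (x := θ))
    simp only [Function.comp_def] at hm3
    rw [lintegral_eq_zero_iff hm3] at hθ
    filter_upwards [hθ] with t ht
    by_contra hcon
    have hmem : Real.exp t • (θ : EuclideanSpace ℝ (Fin n)) ∈ {x | ¬ P (φ' x)} := hcon
    simp [indicator_of_mem hmem, not_le.2 (Real.exp_pos t)] at ht
  rw [← lintegral_const_mul' K _ hK]
  refine lintegral_mono_ae ?_
  filter_upwards [hrep, hPray] with θ ⟨hfL, hf0, hfφ⟩ hPθ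
  set f : ℝ → ℝ := fun t => inner ℝ (h' (Real.exp t • (θ : EuclideanSpace ℝ (Fin n))))
        (Real.exp t • (θ : EuclideanSpace ℝ (Fin n))) with hf
  have hloc : LocallyIntegrable f := hfL.locallyIntegrable (by exact_mod_cast (by omega : 1 ≤ n))
  have hFc : Continuous fun t => ∫ s in (0 : ℝ)..t, f s :=
    intervalIntegral.continuous_primitive (fun x y =>
      (hloc.integrableOn_isCompact isCompact_uIcc).intervalIntegrable) 0
  have hPF : ∀ t, P (∫ s in (0 : ℝ)..t, f s) := by
    -- The primitive is continuous and `P` is closed, so the exceptional set is open and null, hence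
    -- empty.
    have hopen : IsOpen {t : ℝ | ¬ P (∫ s in (0 : ℝ)..t, f s)} :=
      (hPc.preimage hFc).isOpen_compl
    have hnull : volume {t : ℝ | ¬ P (∫ s in (0 : ℝ)..t, f s)} = 0 := by
      have : ∀ᵐ t : ℝ, P (∫ s in (0 : ℝ)..t, f s) := by
        filter_upwards [hfφ, hPθ] with t h1 h2
        rwa [← h1]
      exact this
    intro t
    by_contra hcon
    have : t ∈ {t : ℝ | ¬ P (∫ s in (0 : ℝ)..t, f s)} := hcon
    rw [(hopen.measure_eq_zero_iff volume).1 hnull] at this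
    exact this
  have hset : {t : ℝ | φ' (Real.exp t • (θ : EuclideanSpace ℝ (Fin n))) ≠ 0} =ᵐ[volume]
      {t : ℝ | ∫ s in (0 : ℝ)..t, f s ≠ 0} := by
    rw [eventuallyEq_set]
    filter_upwards [hfφ] with t ht
    simp [ht]
  change ∫⁻ t in {t : ℝ | φ' (Real.exp t • (θ : EuclideanSpace ℝ (Fin n))) ≠ 0}, _ ≤
    K * ∫⁻ t in {t : ℝ | φ' (Real.exp t • (θ : EuclideanSpace ℝ (Fin n))) ≠ 0}, _
  rw [Measure.restrict_congr_set hset]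
  simp_rw [exp_pow_mul_enorm_logPowerGrad]
  refine (hray f hfL hf0 hPF).trans ?_
  gcongr with t
  -- On the competitor's side only the radial component is kept; the gradient of u itself is radial,
  -- so nothing was lost on the other side.
  have := enorm_exp_mul_inner_pow_le ((logPowerGrad n c α + h')
    (Real.exp t • (θ : EuclideanSpace ℝ (Fin n)))) t θ
  rwa [Pi.add_apply, inner_add_left, inner_logPowerGrad] at this

theorem energy_logPowerGrad_le_logPowerConst_mul {n : ℕ} (hn : 2 ≤ n) {γ : ℝ≥0∞} {c α : ℝ}
    (hα : 1 - 1 / (n : ℝ) < α) (hc : 0 < c) {φ : EuclideanSpace ℝ (Fin n) → ℝ}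
    {h : EuclideanSpace ℝ (Fin n) → EuclideanSpace ℝ (Fin n)}
    (hφ : MemSobolevZero n (annulus n 1 γ) φ h) :
    energy n {x ∈ annulus n 1 γ | φ x ≠ 0} (logPowerGrad n c α) ≤
      ENNReal.ofReal (logPowerConst n α) *
        energy n {x ∈ annulus n 1 γ | φ x ≠ 0} (logPowerGrad n c α + h) :=
  energy_logPowerGrad_le hn ENNReal.ofReal_ne_top hφ (fun _ => True) (by simp) trivial (by simp)
    fun _ hf h0 _ => setLIntegral_deriv_rpow_le hn hα hc hf h0

theorem energy_logPowerGrad_le_of_sign {n : ℕ} (hn : 2 ≤ n) {γ : ℝ≥0∞} {c α : ℝ}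
    (hα : 1 - 1 / (n : ℝ) < α) (hc : 0 < c) {φ : EuclideanSpace ℝ (Fin n) → ℝ}
    {h : EuclideanSpace ℝ (Fin n) → EuclideanSpace ℝ (Fin n)}
    (hφ : MemSobolevZero n (annulus n 1 γ) φ h)
    (hsign : ∀ᵐ x ∂(volume.restrict (annulus n 1 γ)), (α - 1) * φ x ≤ 0) :
    energy n {x ∈ annulus n 1 γ | φ x ≠ 0} (logPowerGrad n c α) ≤
      energy n {x ∈ annulus n 1 γ | φ x ≠ 0} (logPowerGrad n c α + h) := by
  have := energy_logPowerGrad_le (K := 1) hn ENNReal.one_ne_top hφ (fun y => (α - 1) * y ≤ 0)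
    hsign (by simp) (isClosed_le (by fun_prop) continuous_const)
    fun _ hf h0 hs => (setLIntegral_deriv_rpow_le_of_sign (c := c) hn hα hc hf h0 hs).trans
      (one_mul _).ge
  rwa [one_mul] at this

/-! ### Weak gradients and Sobolev spaces -/

section Sobolev

variable {n : ℕ} {Ω : Set (EuclideanSpace ℝ (Fin n))}

lemma IsTestFunction.continuous_gradient {ψ : EuclideanSpace ℝ (Fin n) → ℝ}
    (hψ : IsTestFunction Ω ψ) : Continuous (∇ ψ) :=
  (InnerProductSpace.toDual ℝ (EuclideanSpace ℝ (Fin n))).symm.continuous.comp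
    (hψ.1.continuous_fderiv (by simp))

lemma tsupport_gradient_subset (ψ : EuclideanSpace ℝ (Fin n) → ℝ) :
    tsupport (∇ ψ) ⊆ tsupport ψ := by
  refine (closure_mono fun x hx => ?_).trans (tsupport_fderiv_subset ℝ)
  intro h
  exact hx (by simp [gradient, h])

lemma IsTestFunction.hasCompactSupport_gradient {ψ : EuclideanSpace ℝ (Fin n) → ℝ}
    (hψ : IsTestFunction Ω ψ) : HasCompactSupport (∇ ψ) :=
  hψ.2.1.mono' (subset_closure.trans (tsupport_gradient_subset ψ))

/-- The product of a function continuous on an open set and a continuous function compactly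
supported in that set is continuous. -/
lemma continuous_smul_of_tsupport_subset {X E : Type*} [TopologicalSpace X]
    [NormedAddCommGroup E] [NormedSpace ℝ E] {U : Set X} (hU : IsOpen U) {u : X → ℝ} {k : X → E}
    (h : (ContinuousOn u U ∧ Continuous k ∧ tsupport k ⊆ U) ∨
      (ContinuousOn k U ∧ Continuous u ∧ tsupport u ⊆ U)) :
    Continuous fun x => u x • k x := by
  refine continuous_of_tsupport fun x hx => ?_
  rcases h with ⟨h1, h2, h3⟩ | ⟨h1, h2, h3⟩
  · exact (h1.continuousAt (hU.mem_nhds (h3 (tsupport_smul_subset_right u k hx)))).smul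
      h2.continuousAt
  · exact h2.continuousAt.smul
      (h1.continuousAt (hU.mem_nhds (h3 (tsupport_smul_subset_left u k hx))))

/-- Classical gradients are weak gradients. -/
theorem hasWeakGradient_of_hasGradientAt (hΩ : IsOpen Ω) {u : EuclideanSpace ℝ (Fin n) → ℝ}
    {g : EuclideanSpace ℝ (Fin n) → EuclideanSpace ℝ (Fin n)}
    (hu : ∀ x ∈ Ω, HasGradientAt u (g x) x) (hg : ContinuousOn g Ω) : HasWeakGradient Ω u g := by
  have huc : ContinuousOn u Ω := fun x hx => (hu x hx).continuousAt.continuousWithinAt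
  have l1 : LocallyIntegrableOn u Ω volume := huc.locallyIntegrableOn hΩ.measurableSet
  have l2 : LocallyIntegrableOn g Ω volume := hg.locallyIntegrableOn hΩ.measurableSet
  refine ⟨l1, l2, fun ψ hψ => ?_⟩
  have hψc : Continuous ψ := hψ.1.continuous
  have hgts := (tsupport_gradient_subset ψ).trans hψ.2.2
  have c1 : Continuous fun x => u x • ∇ ψ x :=
    continuous_smul_of_tsupport_subset hΩ (Or.inl ⟨huc, hψ.continuous_gradient, hgts⟩)
  have c2 : Continuous fun x => ψ x • g x :=
    continuous_smul_of_tsupport_subset hΩ (Or.inr ⟨hg, hψc, hψ.2.2⟩)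
  have c3 : Continuous fun x => u x • ψ x :=
    continuous_smul_of_tsupport_subset hΩ (Or.inl ⟨huc, hψc, hψ.2.2⟩)
  have s1 : HasCompactSupport fun x => u x • ∇ ψ x :=
    hψ.hasCompactSupport_gradient.mono (Function.support_smul_subset_right u (∇ ψ))
  have s2 : HasCompactSupport fun x => ψ x • g x :=
    hψ.2.1.mono (Function.support_smul_subset_left ψ g)
  have s3 : HasCompactSupport fun x => u x • ψ x :=
    hψ.2.1.mono (Function.support_smul_subset_right u ψ)
  have i1 : Integrable fun x => u x • ∇ ψ x := c1.integrable_of_hasCompactSupport s1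
  have i2 : Integrable fun x => ψ x • g x := c2.integrable_of_hasCompactSupport s2
  have i3 : Integrable fun x => u x • ψ x := c3.integrable_of_hasCompactSupport s3
  have z1 : ∀ x ∉ Ω, u x • ∇ ψ x = 0 := fun x hx => by
    rw [image_eq_zero_of_notMem_tsupport fun hmem => hx (hgts hmem), smul_zero]
  have z2 : ∀ x ∉ Ω, ψ x • g x = 0 := fun x hx => by
    rw [image_eq_zero_of_notMem_tsupport fun hmem => hx (hψ.2.2 hmem), zero_smul]
  rw [setIntegral_eq_integral_of_forall_compl_eq_zero z1,
    setIntegral_eq_integral_of_forall_compl_eq_zero z2]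
  have hext : ∀ a b : EuclideanSpace ℝ (Fin n), (∀ v, inner ℝ v a = inner ℝ v b) → a = b :=
    fun a b => ext_inner_left ℝ
  apply hext
  -- Pairing with a fixed vector v reduces the identity to scalar integration by parts for the
  -- directional derivative along v.
  intro v
  rw [inner_neg_right, ← integral_inner i1, ← integral_inner i2]
  have hI1 := i1.const_inner (𝕜 := ℝ) v
  have hI2 := i2.const_inner (𝕜 := ℝ) v
  have e1 : ∀ x, inner ℝ v (u x • ∇ ψ x) = ContinuousLinearMap.mul ℝ ℝ (u x) (fderiv ℝ ψ x v) :=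
    fun x => by
      rw [inner_smul_right, real_inner_comm, inner_gradient_left, ContinuousLinearMap.mul_apply']
  have e2 : ∀ x, inner ℝ v (ψ x • g x) =
      ContinuousLinearMap.mul ℝ ℝ (InnerProductSpace.toDual ℝ (EuclideanSpace ℝ (Fin n)) (g x) v) (ψ x) := fun x => by
    rw [inner_smul_right, real_inner_comm, ContinuousLinearMap.mul_apply', mul_comm,
      InnerProductSpace.toDual_apply_apply]
  simp only [e1, e2] at hI1 hI2 ⊢
  have key := integral_bilinear_hasFDerivAt_right_eq_neg_left_of_integrable (μ := volume)
    (B := ContinuousLinearMap.mul ℝ ℝ) (f := u) (g := ψ) (v := v)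
    (f' := fun x => InnerProductSpace.toDual ℝ (EuclideanSpace ℝ (Fin n)) (g x)) (g' := fun x => fderiv ℝ ψ x)
    hI2 hI1 i3 (fun x hx => (hu x (hψ.2.2 hx)).hasFDerivAt)
    (fun x _ => (hψ.1.differentiable (by simp) x).hasFDerivAt)
  exact key

theorem memSobolevLoc_of_hasGradientAt (hΩ : IsOpen Ω) {p : ℝ} {u : EuclideanSpace ℝ (Fin n) → ℝ}
    {g : EuclideanSpace ℝ (Fin n) → EuclideanSpace ℝ (Fin n)}
    (hu : ∀ x ∈ Ω, HasGradientAt u (g x) x) (hg : ContinuousOn g Ω) : MemSobolevLoc p Ω u g := by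
  have huc : ContinuousOn u Ω := fun x hx => (hu x hx).continuousAt.continuousWithinAt
  refine ⟨hasWeakGradient_of_hasGradientAt hΩ hu hg, fun K hK hKΩ => ⟨?_, ?_⟩⟩
  · have : IsFiniteMeasure (volume.restrict K) := ⟨by simpa using hK.measure_lt_top⟩
    obtain ⟨C, hC⟩ := hK.exists_bound_of_continuousOn (huc.mono hKΩ)
    exact MemLp.of_bound ((huc.mono hKΩ).aestronglyMeasurable hK.measurableSet) C
      ((ae_restrict_iff' hK.measurableSet).2 (ae_of_all _ hC))
  · have : IsFiniteMeasure (volume.restrict K) := ⟨by simpa using hK.measure_lt_top⟩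
    obtain ⟨C, hC⟩ := hK.exists_bound_of_continuousOn (hg.mono hKΩ)
    exact MemLp.of_bound ((hg.mono hKΩ).aestronglyMeasurable hK.measurableSet) C
      ((ae_restrict_iff' hK.measurableSet).2 (ae_of_all _ hC))

theorem HasWeakGradient.ae_eq (hΩ : IsOpen Ω) {u : EuclideanSpace ℝ (Fin n) → ℝ}
    {g g' : EuclideanSpace ℝ (Fin n) → EuclideanSpace ℝ (Fin n)}
    (h : HasWeakGradient Ω u g) (h' : HasWeakGradient Ω u g') :
    g =ᵐ[volume.restrict Ω] g' := by
  have hint : ∀ {k : EuclideanSpace ℝ (Fin n) → EuclideanSpace ℝ (Fin n)},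
      LocallyIntegrableOn k Ω → ∀ {ψ : EuclideanSpace ℝ (Fin n) → ℝ}, IsTestFunction Ω ψ →
      IntegrableOn (fun x => ψ x • k x) Ω := fun {k} hk {ψ} hψ => by
    have h1 : IntegrableOn k (tsupport ψ) :=
      hk.integrableOn_compact_subset hψ.2.2 hψ.2.1
    have h2 : IntegrableOn (fun x => ψ x • k x) (tsupport ψ) :=
      h1.continuousOn_smul hψ.1.continuous.continuousOn hψ.2.1
    have h3 : Integrable fun x => ψ x • k x :=
      (integrableOn_iff_integrable_of_support_subset (f := fun x => ψ x • k x)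
        ((Function.support_smul_subset_left ψ k).trans subset_closure)).1 h2
    exact h3.integrableOn
  have hz := hΩ.ae_eq_zero_of_integral_contDiff_smul_eq_zero (μ := volume)
    (f := fun x => g x - g' x) (h.2.1.sub h'.2.1) fun ψ h1 h2 h3 => by
      have hψ : IsTestFunction Ω ψ := ⟨h1, h2, h3⟩
      rw [← setIntegral_eq_integral_of_forall_compl_eq_zero (s := Ω)]
      · simp_rw [smul_sub]
        rw [integral_sub (hint h.2.1 hψ) (hint h'.2.1 hψ), sub_eq_zero]
        exact neg_injective ((h.2.2 ψ hψ).symm.trans (h'.2.2 ψ hψ))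
      · intro x hx
        rw [image_eq_zero_of_notMem_tsupport fun hmem => hx (h3 hmem), zero_smul]
  rw [EventuallyEq, ae_restrict_iff' hΩ.measurableSet]
  filter_upwards [hz] with x hx hxΩ
  exact sub_eq_zero.1 (hx hxΩ)

/-- `L^p`-limits of test functions and of their gradients belong to `W^{1,p}_0`. -/
theorem memSobolevZero_of_tendsto (hΩ : IsOpen Ω) {p : ℝ} (hp : 1 ≤ p)
    {φ : EuclideanSpace ℝ (Fin n) → ℝ}
    {h : EuclideanSpace ℝ (Fin n) → EuclideanSpace ℝ (Fin n)}
    (hφ : MemLp φ (ENNReal.ofReal p) (volume.restrict Ω))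
    (hh : MemLp h (ENNReal.ofReal p) (volume.restrict Ω))
    {ψ : ℕ → EuclideanSpace ℝ (Fin n) → ℝ} (hψ : ∀ k, IsTestFunction Ω (ψ k))
    (hψφ : Tendsto (fun k => eLpNorm (fun x => ψ k x - φ x) (ENNReal.ofReal p)
      (volume.restrict Ω)) atTop (𝓝 0))
    (hψh : Tendsto (fun k => eLpNorm (fun x => ∇ (ψ k) x - h x) (ENNReal.ofReal p)
      (volume.restrict Ω)) atTop (𝓝 0)) :
    MemSobolevZero p Ω φ h := by
  have hp' : 1 ≤ ENNReal.ofReal p := by simpa using ENNReal.ofReal_le_ofReal hp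
  refine ⟨⟨⟨?_, ?_, fun χ hχ => ?_⟩, hφ, hh⟩, ψ, hψ, hψφ, hψh⟩
  · exact locallyIntegrableOn_of_locallyIntegrable_restrict (hφ.locallyIntegrable hp')
  · exact locallyIntegrableOn_of_locallyIntegrable_restrict (hh.locallyIntegrable hp')
  -- Both sides of the weak identity for the test functions pass to the limit by Hölder's inequality
  -- with a fixed factor in L^q.
  set q := ENNReal.conjExponent (ENNReal.ofReal p) with hq
  have hpq : (ENNReal.ofReal p).HolderConjugate q := ENNReal.HolderConjugate.conjExponent hp'
  have hqp : ENNReal.HolderTriple q (ENNReal.ofReal p) 1 := hpq.symm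
  have hpq1 : ENNReal.HolderTriple (ENNReal.ofReal p) q 1 := hpq
  have hχL : MemLp χ q (volume.restrict Ω) :=
    (hχ.1.continuous.memLp_of_hasCompactSupport hχ.2.1)
  have hgχL : MemLp (∇ χ) q (volume.restrict Ω) :=
    (hχ.continuous_gradient.memLp_of_hasCompactSupport hχ.hasCompactSupport_gradient)
  have hψL : ∀ k, MemLp (ψ k) (ENNReal.ofReal p) (volume.restrict Ω) := fun k =>
    ((hψ k).1.continuous.memLp_of_hasCompactSupport (hψ k).2.1)
  have hgψL : ∀ k, MemLp (∇ (ψ k)) (ENNReal.ofReal p) (volume.restrict Ω) := fun k =>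
    ((hψ k).continuous_gradient.memLp_of_hasCompactSupport (hψ k).hasCompactSupport_gradient)
  have hweak : ∀ k, ∫ x in Ω, ψ k x • ∇ χ x = -∫ x in Ω, χ x • ∇ (ψ k) x := fun k =>
    (hasWeakGradient_of_hasGradientAt hΩ
      (fun x _ => ((hψ k).1.differentiable (by simp) x).hasGradientAt)
      (hψ k).continuous_gradient.continuousOn).2.2 χ hχ
  have lim1 : Tendsto (fun k => ∫ x in Ω, ψ k x • ∇ χ x) atTop (𝓝 (∫ x in Ω, φ x • ∇ χ x)) := by
    refine tendsto_integral_of_L1' _ (hφ.1.smul hgχL.1)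
      (Eventually.of_forall fun k => memLp_one_iff_integrable.1 (hgχL.smul (hψL k))) ?_
    have hb : ∀ k, eLpNorm (fun x => ψ k x • ∇ χ x - φ x • ∇ χ x) 1
        (volume.restrict Ω) ≤ eLpNorm (fun x => ψ k x - φ x) (ENNReal.ofReal p)
          (volume.restrict Ω) * eLpNorm (∇ χ) q (volume.restrict Ω) := fun k => by
      have hm : AEStronglyMeasurable (fun x => ψ k x - φ x) (volume.restrict Ω) :=
        (hψL k).1.sub hφ.1
      have := eLpNorm_smul_le_mul_eLpNorm (hpqr := hpq1) hgχL.1 hm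
      simp_rw [← sub_smul]
      exact this
    refine tendsto_of_tendsto_of_tendsto_of_le_of_le tendsto_const_nhds ?_ (fun _ => zero_le) hb
    have := ENNReal.Tendsto.mul_const hψφ (Or.inr hgχL.2.ne)
    simpa using this
  have lim2 : Tendsto (fun k => ∫ x in Ω, χ x • ∇ (ψ k) x) atTop (𝓝 (∫ x in Ω, χ x • h x)) := by
    refine tendsto_integral_of_L1' _ (hχL.1.smul hh.1)
      (Eventually.of_forall fun k => memLp_one_iff_integrable.1 ((hgψL k).smul hχL)) ?_
    have hb : ∀ k, eLpNorm (fun x => χ x • ∇ (ψ k) x - χ x • h x) 1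
        (volume.restrict Ω) ≤ eLpNorm χ q (volume.restrict Ω) *
          eLpNorm (fun x => ∇ (ψ k) x - h x) (ENNReal.ofReal p) (volume.restrict Ω) := fun k => by
      have hm : AEStronglyMeasurable (fun x => ∇ (ψ k) x - h x) (volume.restrict Ω) :=
        (hgψL k).1.sub hh.1
      have := eLpNorm_smul_le_mul_eLpNorm (hpqr := hqp) hm hχL.1
      simp_rw [← smul_sub]
      exact this
    refine tendsto_of_tendsto_of_tendsto_of_le_of_le tendsto_const_nhds ?_ (fun _ => zero_le) hb
    have := ENNReal.Tendsto.const_mul hψh (Or.inr hχL.2.ne)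
    simpa using this
  exact tendsto_nhds_unique lim1 ((lim2.neg).congr fun k => (hweak k).symm)

lemma hasGradientAt_comp_log_norm {η : ℝ → ℝ} {d : ℝ} {x : EuclideanSpace ℝ (Fin n)} (hx : x ≠ 0)
    (hη : HasDerivAt η d (Real.log ‖x‖)) :
    HasGradientAt (fun y : EuclideanSpace ℝ (Fin n) => η (Real.log ‖y‖)) ((d / ‖x‖ ^ 2) • x) x := by
  have hx0 : ‖x‖ ≠ 0 := norm_ne_zero_iff.2 hx
  -- Writing log|y| through |y|^2 replaces the derivative of the norm by that of a polynomial.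
  have hlog : ∀ y : EuclideanSpace ℝ (Fin n), Real.log ‖y‖ = 1 / 2 * Real.log (‖y‖ ^ 2) :=
    fun y => by rw [Real.log_pow]; push_cast; ring
  have h1 : HasFDerivAt (fun y : EuclideanSpace ℝ (Fin n) => ‖y‖ ^ 2) (2 • innerSL ℝ x) x :=
    (hasStrictFDerivAt_norm_sq x).hasFDerivAt
  have h2 := ((h1.log (by positivity)).const_mul (1 / 2 : ℝ))
  simp_rw [← hlog] at h2
  have h3 := hη.comp_hasFDerivAt x h2
  rw [hasGradientAt_iff_hasFDerivAt]
  refine h3.congr_fderiv ?_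
  ext v
  simp
  field_simp

lemma one_lt_norm_of_mem_annulus {γ : ℝ≥0∞} {x : EuclideanSpace ℝ (Fin n)}
    (hx : x ∈ annulus n 1 γ) : 1 < ‖x‖ := by
  have h1 := hx.1
  rw [← ofReal_norm, ← ENNReal.ofReal_one] at h1
  exact ENNReal.ofReal_lt_ofReal_iff_of_nonneg zero_le_one |>.1 h1

lemma memSobolevLoc_const_mul_logPower (γ : ℝ≥0∞) (p c α : ℝ) :
    MemSobolevLoc p (annulus n 1 γ) (fun x => c * logPower n α x) (logPowerGrad n c α) := by
  refine memSobolevLoc_of_hasGradientAt (isOpen_annulus n 1 γ) (fun x hx => ?_) fun x hx => ?_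
  · have h1 := one_lt_norm_of_mem_annulus hx
    have hlog : Real.log ‖x‖ ≠ 0 := (Real.log_pos h1).ne'
    have hx0 : x ≠ 0 := norm_ne_zero_iff.1 (by linarith)
    have := hasGradientAt_comp_log_norm hx0
      ((Real.hasDerivAt_rpow_const (p := α) (Or.inl hlog)).const_mul c)
    rw [← mul_assoc] at this
    exact this
  · have h1 := one_lt_norm_of_mem_annulus hx
    have hlog : Real.log ‖x‖ ≠ 0 := (Real.log_pos h1).ne'
    have hx0 : ‖x‖ ≠ 0 := by linarith
    have hx2 : ‖x‖ ^ 2 ≠ 0 := by positivity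
    apply ContinuousAt.continuousWithinAt
    unfold logPowerGrad
    have hl : ContinuousAt (fun y : EuclideanSpace ℝ (Fin n) => Real.log ‖y‖ ^ (α - 1)) x :=
      (continuousAt_id.norm.log hx0).rpow_const (Or.inl hlog)
    exact ((continuousAt_const.mul hl).div (continuousAt_id.norm.pow 2) hx2).smul continuousAt_id

lemma memSobolevLoc_logPower (γ : ℝ≥0∞) (p α : ℝ) :
    MemSobolevLoc p (annulus n 1 γ) (logPower n α) (logPowerGrad n 1 α) := by
  simpa using memSobolevLoc_const_mul_logPower (n := n) γ p 1 α

end Sobolev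

/-! ### Radial functions in W^{1,n}_0 of the annulus -/

lemma contDiff_of_tsupport {E F : Type*} [NormedAddCommGroup E] [NormedSpace ℝ E]
    [NormedAddCommGroup F] [NormedSpace ℝ F] {f : E → F}
    (h : ∀ x ∈ tsupport f, ContDiffAt ℝ ∞ f x) : ContDiff ℝ ∞ f :=
  contDiff_iff_contDiffAt.2 fun x => by
    by_cases hx : x ∈ tsupport f
    · exact h x hx
    · exact contDiffAt_const.congr_of_eventuallyEq (notMem_tsupport_iff_eventuallyEq.1 hx)

/-- Smooth cutoff functions exhausting `(0, b)`. -/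
noncomputable def intervalBump {b : ℝ} (hb : 0 < b) (k : ℕ) : ContDiffBump (b / 2) where
  -- The shift by 2 keeps the inner radius positive already at k = 0.
  rIn := b / 2 - b / (2 * (k + 2))
  rOut := b / 2 - b / (4 * (k + 2))
  rIn_pos := by
    have : b / (2 * (k + 2)) < b / 2 := div_lt_div_of_pos_left hb (by norm_num) (by linarith)
    linarith
  rIn_lt_rOut := by
    have : b / (4 * ((k : ℝ) + 2)) < b / (2 * (k + 2)) :=
      div_lt_div_of_pos_left hb (by positivity) (by linarith)
    linarith

lemma intervalBump_eq_zero {b : ℝ} (hb : 0 < b) (k : ℕ) {t : ℝ}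
    (ht : t ∉ Icc (b / (4 * ((k : ℝ) + 2))) (b - b / (4 * ((k : ℝ) + 2)))) :
    intervalBump hb k t = 0 := by
  refine (intervalBump hb k).zero_of_le_dist ?_
  simp only [intervalBump, Real.dist_eq]
  rw [mem_Icc, not_and_or, not_le, not_le] at ht
  rcases ht with h | h
  · rw [abs_sub_comm]; exact le_trans (by linarith) (le_abs_self _)
  · exact le_trans (by linarith) (le_abs_self _)

lemma tsupport_intervalBump_subset {b : ℝ} (hb : 0 < b) (k : ℕ) :
    tsupport (intervalBump hb k) ⊆ Icc (b / (4 * ((k : ℝ) + 2))) (b - b / (4 * ((k : ℝ) + 2))) :=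
  closure_minimal (fun t ht => by
    by_contra h
    exact ht (intervalBump_eq_zero hb k h)) isClosed_Icc

lemma Icc_subset_Ioo_of_pos {b δ : ℝ} (hδ : 0 < δ) : Icc δ (b - δ) ⊆ Ioo 0 b :=
  fun t ht => ⟨hδ.trans_le ht.1, by linarith [ht.2]⟩

lemma tendsto_intervalBump {b t : ℝ} (hb : 0 < b) (ht : t ∈ Ioo 0 b) :
    Tendsto (fun k => intervalBump hb k t) atTop (𝓝 1) := by
  have h1 : Tendsto (fun k : ℕ => b / (2 * ((k : ℝ) + 2))) atTop (𝓝 0) := by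
    refine Tendsto.div_atTop tendsto_const_nhds ?_
    exact Tendsto.const_mul_atTop (by norm_num)
      (tendsto_atTop_add_const_right _ _ tendsto_natCast_atTop_atTop)
  have h2 : 0 < min t (b - t) := lt_min ht.1 (by linarith [ht.2])
  refine tendsto_const_nhds.congr' ?_
  filter_upwards [h1.eventually_lt_const h2] with k hk
  symm
  refine (intervalBump hb k).one_of_mem_closedBall ?_
  rw [Metric.mem_closedBall, Real.dist_eq, abs_le]
  simp only [intervalBump]
  have := hk.trans_le (min_le_left _ _)
  have := hk.trans_le (min_le_right _ _)
  constructor <;> linarith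

/-- Smooth compactly supported approximation, in the sense of `L^n`-convergence of derivatives, of
the primitive of a mean-zero function on an interval. -/
theorem exists_contDiff_tendsto_deriv {n : ℕ} (hn : 2 ≤ n) {b : ℝ} (hb : 0 < b) {F : ℝ → ℝ}
    (hF : ContDiffOn ℝ ∞ F (Ioo 0 b)) (hF0 : ∀ t ∉ Ioo 0 b, F t = 0) (hFn : MemLp F n)
    (hFi : ∫ t, F t = 0) :
    ∃ η : ℕ → ℝ → ℝ, (∀ k, ContDiff ℝ ∞ (η k)) ∧
      (∀ k, ∃ δ > 0, ∀ t ∉ Icc δ (b - δ), η k t = 0) ∧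
      Tendsto (fun k => ∫⁻ t, ‖deriv (η k) t - F t‖ₑ ^ n) atTop (𝓝 0) := by
  have hn0 : n ≠ 0 := by omega
  have hFint : Integrable F := by
    rw [← memLp_one_iff_integrable]
    exact hFn.mono_exponent_of_measure_support_ne_top (s := Ioo 0 b) hF0 (by simp)
      (by exact_mod_cast (by omega : 1 ≤ n))
  set χ : ℕ → ℝ → ℝ := fun k => intervalBump hb k with hχ
  have hχs : ∀ k, ContDiff ℝ ∞ (χ k) := fun k => (intervalBump hb k).contDiff
  have hχ0 : ∀ k t, 0 ≤ χ k t := fun k t => (intervalBump hb k).nonneg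
  have hχ1 : ∀ k t, χ k t ≤ 1 := fun k t => (intervalBump hb k).le_one
  set ρ : ℝ → ℝ := (intervalBump hb 0).normed volume with hρ
  have hρs : ContDiff ℝ ∞ ρ := (intervalBump hb 0).contDiff_normed
  have hρi : ∫ t, ρ t = 1 := (intervalBump hb 0).integral_normed
  have hρc : HasCompactSupport ρ := (intervalBump hb 0).hasCompactSupport_normed
  have hρint : Integrable ρ := hρs.continuous.integrable_of_hasCompactSupport hρc
  have hFχs : ∀ k, ContDiff ℝ ∞ fun t => F t * χ k t := fun k => by
    refine contDiff_of_tsupport fun t ht => ?_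
    have htI : t ∈ Ioo 0 b := Icc_subset_Ioo_of_pos (by positivity)
      (tsupport_intervalBump_subset hb k (tsupport_mul_subset_right ht))
    exact (hF.contDiffAt (isOpen_Ioo.mem_nhds htI)).mul (hχs k).contDiffAt
  set c : ℕ → ℝ := fun k => ∫ t, F t * χ k t with hc
  have hFχi : ∀ k, Integrable fun t => F t * χ k t := fun k => by
    refine hFint.norm.mono' (hFχs k).continuous.aestronglyMeasurable (ae_of_all _ fun t => ?_)
    rw [norm_mul, Real.norm_of_nonneg (hχ0 k t)]
    exact mul_le_of_le_one_right (norm_nonneg _) (hχ1 k t)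
  -- Cutting F off destroys its mean value; subtracting `c k` times a fixed bump of integral 1
  -- restores it. The primitive then vanishes near both ends, and the correction tends to 0 because
  -- F has mean zero.
  set f : ℕ → ℝ → ℝ := fun k t => F t * χ k t - c k * ρ t with hf
  have hfs : ∀ k, ContDiff ℝ ∞ (f k) := fun k => (hFχs k).sub (contDiff_const.mul hρs)
  have hfi : ∀ k, Integrable (f k) := fun k => (hFχi k).sub (hρint.const_mul _)
  have hfI : ∀ k, ∫ t, f k t = 0 := fun k => by
    rw [integral_sub (hFχi k) (hρint.const_mul _), integral_const_mul, hρi, mul_one, sub_self]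
  have hρz : ∀ t ∉ Icc (b / (4 * 2)) (b - b / (4 * 2)), ρ t = 0 := fun t ht => by
    simp only [hρ, ContDiffBump.normed]
    rw [intervalBump_eq_zero hb 0 (by simpa using ht), zero_div]
  have hδ : ∀ k : ℕ, b / (4 * ((k : ℝ) + 2)) ≤ b / (4 * 2) := fun k =>
    div_le_div_of_nonneg_left hb.le (by norm_num) (by linarith [(Nat.cast_nonneg k : (0 : ℝ) ≤ k)])
  have hfz : ∀ k : ℕ, ∀ t ∉ Icc (b / (4 * ((k : ℝ) + 2))) (b - b / (4 * ((k : ℝ) + 2))), f k t = 0 :=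
    fun k t ht => by
      simp only [hf, hχ]
      rw [intervalBump_eq_zero hb k ht, hρz t fun h =>
        ht ⟨(hδ k).trans h.1, h.2.trans (by linarith [hδ k])⟩]
      simp
  set η : ℕ → ℝ → ℝ := fun k t => ∫ s in (0 : ℝ)..t, f k s with hη
  have hηd : ∀ k t, HasDerivAt (η k) (f k t) t := fun k t =>
    intervalIntegral.integral_hasDerivAt_right ((hfi k).intervalIntegrable)
      ((hfs k).continuous.stronglyMeasurableAtFilter _ _) (hfs k).continuous.continuousAt
  have hηderiv : ∀ k, deriv (η k) = f k := fun k => funext fun t => (hηd k t).deriv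
  refine ⟨η, fun k => ?_, fun k => ⟨b / (4 * ((k : ℝ) + 2)), by positivity, fun t ht => ?_⟩, ?_⟩
  · rw [contDiff_infty_iff_deriv, hηderiv]
    exact ⟨fun t => (hηd k t).differentiableAt, hfs k⟩
  · set δ := b / (4 * ((k : ℝ) + 2)) with hδd
    have hδ0 : 0 < δ := by positivity
    rw [mem_Icc, not_and_or, not_le, not_le] at ht
    simp only [hη]
    have hδb : δ ≤ b / 2 := (hδ k).trans (by linarith)
    rcases ht with ht | ht
    · refine intervalIntegral.integral_zero_ae (ae_of_all _ fun s hs => hfz k s fun h => ?_)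
      have : s ≤ max 0 t := hs.2
      have : max 0 t < δ := max_lt hδ0 ht
      linarith [h.1]
    · have h0t : 0 ≤ t := by linarith
      rw [intervalIntegral.integral_of_le h0t, setIntegral_eq_integral_of_forall_compl_eq_zero,
        hfI k]
      exact fun s hs => hfz k s fun h => hs ⟨by linarith [h.1], by linarith [h.2]⟩
  · simp_rw [hηderiv]
    have hclim : Tendsto c atTop (𝓝 0) := by
      rw [← hFi]
      refine tendsto_integral_of_dominated_convergence (fun t => ‖F t‖)
        (fun k => (hFχi k).1) hFint.norm (fun k => ae_of_all _ fun t => ?_)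
        (ae_of_all _ fun t => ?_)
      · rw [norm_mul, Real.norm_of_nonneg (hχ0 k t)]
        exact mul_le_of_le_one_right (norm_nonneg _) (hχ1 k t)
      · by_cases ht : t ∈ Ioo 0 b
        · simpa using (tendsto_intervalBump hb ht).const_mul (F t)
        · simp [hF0 t ht]
    have hcb : ∀ k, |c k| ≤ ∫ t, ‖F t‖ := fun k => by
      refine (norm_integral_le_integral_norm _).trans (integral_mono (hFχi k).norm hFint.norm
        fun t => ?_)
      simp only
      rw [norm_mul, Real.norm_of_nonneg (hχ0 k t)]
      exact mul_le_of_le_one_right (norm_nonneg _) (hχ1 k t)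
    set C := ∫ t, ‖F t‖ with hC
    have hρn : MemLp ρ n := hρs.continuous.memLp_of_hasCompactSupport hρc
    have hbd : MemLp (fun t => ‖F t‖ + C * ‖ρ t‖) n := hFn.norm.add (hρn.norm.const_mul C)
    have hbd' := ((memLp_natCast_iff hn0 hbd.1).1 hbd).ne
    have hm : ∀ k, AEMeasurable (fun t => ‖f k t - F t‖ₑ ^ n) := fun k =>
      (((hfs k).continuous.aestronglyMeasurable.sub hFn.1).enorm).pow_const n
    have := tendsto_lintegral_of_dominated_convergence' (μ := volume)
      (F := fun k t => ‖f k t - F t‖ₑ ^ n) (f := fun _ => 0) _ hm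
      (fun k => ae_of_all _ fun t => ?_) hbd' (ae_of_all _ fun t => ?_)
    · simpa using this
    · refine pow_le_pow_left₀ zero_le ?_ n
      rw [enorm_le_iff_norm_le, Real.norm_of_nonneg (r := ‖F t‖ + C * ‖ρ t‖)
        (by have : 0 ≤ C := integral_nonneg fun _ => norm_nonneg _
            positivity)]
      have e : f k t - F t = -(F t * (1 - χ k t)) - c k * ρ t := by simp only [hf]; ring
      rw [e]
      refine (norm_sub_le _ _).trans (add_le_add ?_ ?_)
      · rw [norm_neg, norm_mul, Real.norm_of_nonneg (sub_nonneg.2 (hχ1 k t))]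
        exact mul_le_of_le_one_right (norm_nonneg _) (by linarith [hχ0 k t])
      · rw [norm_mul]
        exact mul_le_mul_of_nonneg_right (hcb k) (norm_nonneg _)
    · have h1 : Tendsto (fun k => f k t - F t) atTop (𝓝 0) := by
        have h2 : Tendsto (fun k => F t * χ k t) atTop (𝓝 (F t)) := by
          by_cases ht : t ∈ Ioo 0 b
          · simpa using (tendsto_intervalBump hb ht).const_mul (F t)
          · simp [hF0 t ht]
        simpa using (h2.sub (hclim.mul_const (ρ t))).sub_const (F t)
      have h3 := ((ENNReal.continuous_pow n).tendsto _).comp h1.enorm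
      simpa [hn0, Function.comp_def] using h3

lemma isTestFunction_comp_log_norm {n : ℕ} {γ : ℝ≥0∞} {b δ : ℝ}
    (hbγ : ∀ t ∈ Ioo 0 b, ENNReal.ofReal (Real.exp t) < γ) {η : ℝ → ℝ} (hη : ContDiff ℝ ∞ η)
    (hδ : 0 < δ) (hη0 : ∀ t ∉ Icc δ (b - δ), η t = 0) :
    IsTestFunction (annulus n 1 γ) (fun x => η (Real.log ‖x‖)) := by
  set K : Set (EuclideanSpace ℝ (Fin n)) := {x | Real.exp δ ≤ ‖x‖ ∧ ‖x‖ ≤ Real.exp (b - δ)} with hK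
  have hKc : IsClosed K :=
    (isClosed_le continuous_const continuous_norm).inter (isClosed_le continuous_norm continuous_const)
  have hKcomp : IsCompact K := Metric.isCompact_of_isClosed_isBounded hKc
    ((Metric.isBounded_closedBall (x := 0) (r := Real.exp (b - δ))).subset
      fun x hx => by simpa using hx.2)
  have hsupp : Function.support (fun x : EuclideanSpace ℝ (Fin n) => η (Real.log ‖x‖)) ⊆ K :=
    fun x hx => by
      have h1 : Real.log ‖x‖ ∈ Icc δ (b - δ) := by
        by_contra h
        exact hx (hη0 _ h)
      have hx0 : 0 < ‖x‖ := by
        rcases (norm_nonneg x).eq_or_lt with h | h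
        -- The junk value log 0 = 0 lies below δ, so the origin is not in the support.
        · rw [← h, Real.log_zero] at h1
          linarith [h1.1]
        · exact h
      exact ⟨(Real.le_log_iff_exp_le hx0).1 h1.1, (Real.log_le_iff_le_exp hx0).1 h1.2⟩
  have hts : tsupport (fun x : EuclideanSpace ℝ (Fin n) => η (Real.log ‖x‖)) ⊆ K :=
    closure_minimal hsupp hKc
  have hK1 : ∀ x ∈ K, 1 < ‖x‖ := fun x hx => (Real.one_lt_exp_iff.2 hδ).trans_le hx.1
  refine ⟨contDiff_of_tsupport fun x hx => ?_, HasCompactSupport.of_support_subset_isCompact hKcomp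
    hsupp, fun x hx => ?_⟩
  · have hx0 : ‖x‖ ≠ 0 := by linarith [hK1 x (hts hx)]
    exact hη.contDiffAt.comp x ((contDiffAt_norm ℝ (norm_ne_zero_iff.1 hx0)).log hx0)
  · have hxK := hts hx
    have h1 := hK1 x hxK
    refine ⟨?_, ?_⟩
    · rw [← ofReal_norm, ← ENNReal.ofReal_one]
      exact (ENNReal.ofReal_lt_ofReal_iff (by linarith)).2 h1
    · rw [← ofReal_norm, ← Real.exp_log (by linarith : 0 < ‖x‖)]
      refine hbγ _ ⟨Real.log_pos h1, ?_⟩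
      have := (Real.log_le_iff_le_exp (by linarith)).2 hxK.2
      linarith

lemma lintegral_comp_log_norm {n : ℕ} (hn : 1 ≤ n) {D : ℝ → ℝ} (hD : Measurable D) (m : ℕ) :
    ∫⁻ x : EuclideanSpace ℝ (Fin n), ‖D (Real.log ‖x‖)‖ₑ ^ m =
      (volume : Measure (EuclideanSpace ℝ (Fin n))).toSphere univ *
        ∫⁻ t : ℝ, ENNReal.ofReal (Real.exp t) ^ n * ‖D t‖ₑ ^ m := by
  have hm : Measurable fun x : EuclideanSpace ℝ (Fin n) => ‖D (Real.log ‖x‖)‖ₑ ^ m :=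
    ((hD.comp (Real.measurable_log.comp measurable_norm)).enorm).pow_const m
  rw [lintegral_logPolar hn hm]
  simp_rw [norm_exp_smul, Real.log_exp]
  rw [lintegral_const, mul_comm]

/-- Here the weight e^{nt} cancels, unlike in `lintegral_comp_log_norm`; convergence of gradients in
L^n is therefore exactly convergence of the profiles' derivatives. -/
lemma lintegral_radial_gradient {n : ℕ} (hn : 1 ≤ n) {D : ℝ → ℝ} (hD : Measurable D) :
    ∫⁻ x : EuclideanSpace ℝ (Fin n), ‖(D (Real.log ‖x‖) / ‖x‖ ^ 2) • x‖ₑ ^ n =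
      (volume : Measure (EuclideanSpace ℝ (Fin n))).toSphere univ * ∫⁻ t : ℝ, ‖D t‖ₑ ^ n := by
  have hm : Measurable fun x : EuclideanSpace ℝ (Fin n) =>
      ‖(D (Real.log ‖x‖) / ‖x‖ ^ 2) • x‖ₑ ^ n :=
    ((((hD.comp (Real.measurable_log.comp measurable_norm)).div
      (measurable_norm.pow_const 2)).smul measurable_id).enorm).pow_const n
  rw [lintegral_logPolar hn hm]
  have : ∀ (θ : Metric.sphere (0 : EuclideanSpace ℝ (Fin n)) 1) (t : ℝ),
      ENNReal.ofReal (Real.exp t) ^ n * ‖(D (Real.log ‖Real.exp t •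
        (θ : EuclideanSpace ℝ (Fin n))‖) / ‖Real.exp t • (θ : EuclideanSpace ℝ (Fin n))‖ ^ 2) •
        (Real.exp t • (θ : EuclideanSpace ℝ (Fin n)))‖ₑ ^ n = ‖D t‖ₑ ^ n := fun θ t => by
    have he := Real.exp_pos t
    rw [← mul_pow, norm_exp_smul, enorm_smul, enorm_exp_smul, Real.log_exp,
      ← Real.enorm_of_nonneg he.le, ← enorm_mul, ← enorm_mul]
    congr 2
    field_simp
  simp_rw [this]
  rw [lintegral_const, mul_comm]

lemma integral_eq_zero_of_notMem_Ioo {b : ℝ} (hb : 0 < b) {F : ℝ → ℝ}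
    (hF0 : ∀ t ∉ Ioo 0 b, F t = 0) (hFi : ∫ t, F t = 0) {t : ℝ} (ht : t ∉ Ioo 0 b) :
    ∫ s in (0 : ℝ)..t, F s = 0 := by
  rw [mem_Ioo, not_and_or, not_lt, not_lt] at ht
  rcases ht with ht | ht
  · refine intervalIntegral.integral_zero_ae (ae_of_all _ fun s hs => hF0 s fun h => ?_)
    rw [uIoc_of_ge ht] at hs
    linarith [h.1, hs.2]
  · rw [intervalIntegral.integral_of_le (hb.le.trans ht),
      setIntegral_eq_integral_of_forall_compl_eq_zero, hFi]
    exact fun s hs => hF0 s fun h => hs ⟨h.1, h.2.le.trans ht⟩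

/-- Radial functions whose profile in `log |x|` is the primitive of a mean-zero function on an
interval belong to `W^{1,n}_0`. -/
theorem memSobolevZero_radial {n : ℕ} (hn : 2 ≤ n) {γ : ℝ≥0∞} {b : ℝ} (hb : 0 < b)
    (hbγ : ∀ t ∈ Ioo 0 b, ENNReal.ofReal (Real.exp t) < γ) {F : ℝ → ℝ} (hFm : Measurable F)
    (hF : ContDiffOn ℝ ∞ F (Ioo 0 b)) (hF0 : ∀ t ∉ Ioo 0 b, F t = 0) (hFn : MemLp F n)
    (hFi : ∫ t, F t = 0) :
    MemSobolevZero n (annulus n 1 γ) (fun x => ∫ s in (0 : ℝ)..Real.log ‖x‖, F s)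
      (fun x => (F (Real.log ‖x‖) / ‖x‖ ^ 2) • x) := by
  have hn0 : n ≠ 0 := by omega
  have hn1 : 1 ≤ n := by omega
  obtain ⟨η, hηs, hη0, hηlim⟩ := exists_contDiff_tendsto_deriv hn hb hF hF0 hFn hFi
  have hFint : Integrable F := by
    rw [← memLp_one_iff_integrable]
    exact hFn.mono_exponent_of_measure_support_ne_top (s := Ioo 0 b) hF0 (by simp)
      (by exact_mod_cast hn1)
  set P : ℝ → ℝ := fun t => ∫ s in (0 : ℝ)..t, F s with hP
  have hPc : Continuous P := intervalIntegral.continuous_primitive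
    (fun _ _ => hFint.intervalIntegrable) 0
  have hP0 : ∀ t ∉ Ioo 0 b, P t = 0 := fun t => integral_eq_zero_of_notMem_Ioo hb hF0 hFi
  set σ := (volume : Measure (EuclideanSpace ℝ (Fin n))).toSphere univ with hσ
  have hσ' : σ ≠ ⊤ := measure_ne_top _ _
  have hroot : ∀ {E : Type} [NormedAddCommGroup E] {G : ℕ → EuclideanSpace ℝ (Fin n) → E},
      Tendsto (fun k => ∫⁻ x, ‖G k x‖ₑ ^ n) atTop (𝓝 0) →
      Tendsto (fun k => eLpNorm (G k) (ENNReal.ofReal n)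
        (volume.restrict (annulus n 1 γ))) atTop (𝓝 0) := fun {E} _ {G} h => by
    have h1 := (ENNReal.continuous_rpow_const (y := 1 / (n : ℝ))).tendsto 0 |>.comp h
    rw [ENNReal.zero_rpow_of_pos (by positivity)] at h1
    refine tendsto_of_tendsto_of_tendsto_of_le_of_le tendsto_const_nhds h1 (fun _ => zero_le)
      fun k => (eLpNorm_restrict_le _ _ _ _).trans (le_of_eq ?_)
    simp only [Function.comp, ENNReal.ofReal_natCast]
    rw [← eLpNorm_natCast_pow hn0, ← ENNReal.rpow_natCast, ← ENNReal.rpow_mul,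
      mul_one_div_cancel (by exact_mod_cast hn0), ENNReal.rpow_one]
  have hlogm : Measurable fun x : EuclideanSpace ℝ (Fin n) => Real.log ‖x‖ :=
    Real.measurable_log.comp measurable_norm
  -- The functions themselves keep the weight e^{nt}, which is at most e^{nb} as the profiles live
  -- on (0, b). This also works in an unbounded annulus.
  have hexp : ∀ {D : ℝ → ℝ}, Measurable D → (∀ t ∉ Ioo 0 b, D t = 0) →
      ∀ {M : ℝ≥0∞}, (∀ t ∈ Ioo 0 b, ‖D t‖ₑ ^ n ≤ M) →
      ∫⁻ t : ℝ, ENNReal.ofReal (Real.exp t) ^ n * ‖D t‖ₑ ^ n ≤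
        ENNReal.ofReal (Real.exp b) ^ n * ENNReal.ofReal b * M := fun {D} hD hD0 {M} hM => by
    rw [← setLIntegral_eq_of_support_subset (s := Ioo 0 b)]
    · calc _ ≤ ∫⁻ t in Ioo 0 b, ENNReal.ofReal (Real.exp b) ^ n * M :=
            setLIntegral_mono measurable_const fun t ht => by
              gcongr
              · exact ht.2.le
              · exact hM t ht
        _ = _ := by
            rw [setLIntegral_const, Real.volume_Ioo, sub_zero]
            ring
    · intro t ht
      by_contra h
      exact ht (by simp [hD0 t h, hn0])
  have hηc : ∀ k, ∀ t ∉ Ioo 0 b, η k t = 0 := fun k t ht => by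
    obtain ⟨δ, hδ, h⟩ := hη0 k
    exact h t fun h' => ht (Icc_subset_Ioo_of_pos hδ h')
  have hdm : ∀ k, Continuous (deriv (η k)) := fun k => (hηs k).continuous_deriv (by simp)
  refine memSobolevZero_of_tendsto (isOpen_annulus n 1 γ) (by exact_mod_cast hn1)
    (ψ := fun k x => η k (Real.log ‖x‖)) ?_ ?_ (fun k => ?_) (hroot ?_) (hroot ?_)
  · rw [ENNReal.ofReal_natCast]
    refine MemLp.restrict _ ((memLp_natCast_iff hn0
      (hPc.measurable.comp hlogm).aestronglyMeasurable).2 ?_)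
    simp only [Function.comp_def]
    rw [lintegral_comp_log_norm hn1 hPc.measurable]
    refine ENNReal.mul_lt_top hσ'.lt_top ?_
    refine (hexp hPc.measurable hP0 (M := ENNReal.ofReal b ^ (n - 1) * ∫⁻ t, ‖F t‖ₑ ^ n)
      fun t ht => ?_).trans_lt ?_
    · refine (enorm_integral_pow_le hn hFn.1 ht.1.le).trans ?_
      gcongr
      linarith [ht.2]
    · have := (memLp_natCast_iff hn0 hFn.1).1 hFn
      finiteness
  · rw [ENNReal.ofReal_natCast]
    have hm : Measurable fun x : EuclideanSpace ℝ (Fin n) => (F (Real.log ‖x‖) / ‖x‖ ^ 2) • x :=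
      ((hFm.comp hlogm).div (measurable_norm.pow_const 2)).smul measurable_id
    refine MemLp.restrict _ ((memLp_natCast_iff hn0 hm.aestronglyMeasurable).2 ?_)
    rw [lintegral_radial_gradient hn1 hFm]
    exact ENNReal.mul_lt_top hσ'.lt_top ((memLp_natCast_iff hn0 hFn.1).1 hFn)
  · obtain ⟨δ, hδ, h⟩ := hη0 k
    exact isTestFunction_comp_log_norm hbγ (hηs k) hδ h
  · have hle : ∀ k, ∫⁻ x : EuclideanSpace ℝ (Fin n), ‖η k (Real.log ‖x‖) - P (Real.log ‖x‖)‖ₑ ^ n ≤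
        σ * (ENNReal.ofReal (Real.exp b) ^ n * ENNReal.ofReal b *
          (ENNReal.ofReal b ^ (n - 1) * ∫⁻ t, ‖deriv (η k) t - F t‖ₑ ^ n)) := fun k => by
      have hD : Measurable fun t => η k t - P t :=
        (hηs k).continuous.measurable.sub hPc.measurable
      rw [lintegral_comp_log_norm hn1 hD]
      gcongr
      refine hexp hD (fun t ht => by rw [hηc k t ht, hP0 t ht, sub_zero]) fun t ht => ?_
      have hFTC : η k t = ∫ s in (0 : ℝ)..t, deriv (η k) s := by
        rw [intervalIntegral.integral_deriv_eq_sub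
          (fun s _ => (hηs k).differentiable (by simp) s)
          ((hdm k).intervalIntegrable _ _), hηc k 0 (by simp), sub_zero]
      have hsub : η k t - P t = ∫ s in (0 : ℝ)..t, (deriv (η k) s - F s) := by
        rw [hFTC, intervalIntegral.integral_sub ((hdm k).intervalIntegrable _ _)
          hFint.intervalIntegrable]
      rw [hsub]
      refine (enorm_integral_pow_le hn ((hdm k).aestronglyMeasurable.sub hFn.1) ht.1.le).trans ?_
      simp only [Pi.sub_apply]
      gcongr
      linarith [ht.2]
    refine tendsto_of_tendsto_of_tendsto_of_le_of_le tendsto_const_nhds ?_ (fun _ => zero_le) hle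
    have h1 := ENNReal.Tendsto.const_mul (a := ENNReal.ofReal b ^ (n - 1)) hηlim
      (Or.inr (by finiteness))
    have h2 := ENNReal.Tendsto.const_mul
      (a := ENNReal.ofReal (Real.exp b) ^ n * ENNReal.ofReal b) h1 (Or.inr (by finiteness))
    have h3 := ENNReal.Tendsto.const_mul (a := σ) h2 (Or.inr hσ')
    simpa using h3
  · have heq : ∀ k, ∫⁻ x : EuclideanSpace ℝ (Fin n),
        ‖∇ (fun x => η k (Real.log ‖x‖)) x - (F (Real.log ‖x‖) / ‖x‖ ^ 2) • x‖ₑ ^ n =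
        σ * ∫⁻ t, ‖deriv (η k) t - F t‖ₑ ^ n := fun k => by
      have hD : Measurable fun t => deriv (η k) t - F t := (hdm k).measurable.sub hFm
      rw [← lintegral_radial_gradient hn1 hD]
      have hE : Nontrivial (EuclideanSpace ℝ (Fin n)) := by
        have : Nonempty (Fin n) := ⟨⟨0, hn1⟩⟩
        infer_instance
      have hne : ∀ᵐ x : EuclideanSpace ℝ (Fin n), x ≠ 0 := by simp [ae_iff]
      refine lintegral_congr_ae ?_
      filter_upwards [hne] with x hx
      rw [(hasGradientAt_comp_log_norm hx
        ((hηs k).differentiable (by simp) _).hasDerivAt).gradient, ← sub_smul, ← sub_div]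
    simp_rw [heq]
    have := ENNReal.Tendsto.const_mul (a := σ) hηlim (Or.inr hσ')
    simpa using this

/-! ### Stability of W^{1,p}_0 -/

section Zero

variable {n : ℕ} {Ω : Set (EuclideanSpace ℝ (Fin n))} {p : ℝ} {φ : EuclideanSpace ℝ (Fin n) → ℝ}
  {h : EuclideanSpace ℝ (Fin n) → EuclideanSpace ℝ (Fin n)}

lemma MemSobolevZero.congr (hΩ : IsOpen Ω) (hp : 1 ≤ p) (hφ : MemSobolevZero p Ω φ h)
    {φ' : EuclideanSpace ℝ (Fin n) → ℝ}
    {h' : EuclideanSpace ℝ (Fin n) → EuclideanSpace ℝ (Fin n)}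
    (e : ∀ x ∈ Ω, φ x = φ' x) (e' : ∀ x ∈ Ω, h x = h' x) : MemSobolevZero p Ω φ' h' := by
  have ae1 : φ =ᵐ[volume.restrict Ω] φ' :=
    (ae_restrict_iff' hΩ.measurableSet).2 (ae_of_all _ e)
  have ae2 : h =ᵐ[volume.restrict Ω] h' :=
    (ae_restrict_iff' hΩ.measurableSet).2 (ae_of_all _ e')
  obtain ⟨⟨-, h1, h2⟩, ψ, hψ, l1, l2⟩ := hφ
  refine memSobolevZero_of_tendsto hΩ hp (h1.ae_eq ae1) (h2.ae_eq ae2) hψ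
    (l1.congr fun k => eLpNorm_congr_ae ?_) (l2.congr fun k => eLpNorm_congr_ae ?_)
  · filter_upwards [ae1] with x hx
    rw [hx]
  · filter_upwards [ae2] with x hx
    rw [hx]

lemma gradient_neg (ψ : EuclideanSpace ℝ (Fin n) → ℝ) (x : EuclideanSpace ℝ (Fin n)) :
    ∇ (-ψ) x = -∇ ψ x := by
  simp [gradient, fderiv_neg]

lemma MemSobolevZero.neg (hΩ : IsOpen Ω) (hp : 1 ≤ p) (hφ : MemSobolevZero p Ω φ h) :
    MemSobolevZero p Ω (-φ) (-h) := by
  obtain ⟨⟨-, h1, h2⟩, ψ, hψ, l1, l2⟩ := hφ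
  refine memSobolevZero_of_tendsto hΩ hp h1.neg h2.neg (ψ := fun k => -ψ k)
    (fun k => ⟨(hψ k).1.neg, ?_, ?_⟩) (l1.congr fun k => ?_) (l2.congr fun k => ?_)
  · exact (hψ k).2.1.mono (by simp)
  · refine Subset.trans (closure_mono ?_) (hψ k).2.2
    simp
  · rw [← eLpNorm_neg]
    congr 1
    ext x
    simp only [Pi.neg_apply]
    ring
  · rw [← eLpNorm_neg]
    congr 1
    ext1 x
    simp only [Pi.neg_apply, gradient_neg]
    abel

end Zero

lemma energy_neg {n : ℕ} (p : ℝ) (S : Set (EuclideanSpace ℝ (Fin n)))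
    (g : EuclideanSpace ℝ (Fin n) → EuclideanSpace ℝ (Fin n)) :
    energy p S (-g) = energy p S g := by
  simp [energy]

/-! ### The chord competitor and its energy -/

/-- The difference between the derivative of a chord of `t ↦ t ^ α` and that of the function. -/
noncomputable def chordDeriv (α b : ℝ) : ℝ → ℝ :=
  (Ioo 0 b).indicator fun t => b ^ (α - 1) - α * t ^ (α - 1)

section Chord

variable {n : ℕ} {α b : ℝ}

lemma measurable_chordDeriv : Measurable (chordDeriv α b) :=
  (by fun_prop : Measurable fun t : ℝ => b ^ (α - 1) - α * t ^ (α - 1)).indicator measurableSet_Ioo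

lemma chordDeriv_of_mem {t : ℝ} (ht : t ∈ Ioo 0 b) :
    chordDeriv α b t = b ^ (α - 1) - α * t ^ (α - 1) :=
  indicator_of_mem ht _

lemma chordDeriv_of_notMem {t : ℝ} (ht : t ∉ Ioo 0 b) : chordDeriv α b t = 0 :=
  indicator_of_notMem ht _

lemma contDiffOn_chordDeriv : ContDiffOn ℝ ∞ (chordDeriv α b) (Ioo 0 b) := by
  have h : ContDiffOn ℝ ∞ (fun t : ℝ => b ^ (α - 1) - α * t ^ (α - 1)) (Ioo 0 b) := fun t ht =>
    (contDiffAt_const.sub (contDiffAt_const.mul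
      (Real.contDiffAt_rpow_const_of_ne ht.1.ne'))).contDiffWithinAt
  exact h.congr fun t ht => chordDeriv_of_mem ht

lemma memLp_deriv_rpow (hn : 2 ≤ n) (hα : 1 - 1 / (n : ℝ) < α) (hb : 0 ≤ b) :
    MemLp (fun t : ℝ => α * t ^ (α - 1)) n (volume.restrict (Ioo 0 b)) := by
  have hm : Measurable fun t : ℝ => α * t ^ (α - 1) := by fun_prop
  refine (memLp_natCast_iff (by omega) hm.aestronglyMeasurable).2 ?_
  have := lintegral_deriv_rpow_pow hn hα zero_le_one le_rfl hb
  simp only [one_mul] at this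
  rw [this]
  exact ENNReal.ofReal_lt_top

lemma memLp_chordDeriv (hn : 2 ≤ n) (hα : 1 - 1 / (n : ℝ) < α) (hb : 0 ≤ b) :
    MemLp (chordDeriv α b) n := by
  have : IsFiniteMeasure (volume.restrict (Ioo 0 b)) := ⟨by simp⟩
  exact (memLp_indicator_iff_restrict measurableSet_Ioo).2
    ((memLp_const _).sub (memLp_deriv_rpow hn hα hb))

lemma integral_chordDeriv_of_mem (hα : 0 < α) {t : ℝ} (ht : t ∈ Icc 0 b) :
    ∫ s in (0 : ℝ)..t, chordDeriv α b s = b ^ (α - 1) * t - t ^ α := by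
  have hne : ∀ᵐ s : ℝ, s ≠ b := by simp [ae_iff]
  have h1 : ∫ s in (0 : ℝ)..t, chordDeriv α b s =
      ∫ s in (0 : ℝ)..t, (b ^ (α - 1) - α * s ^ (α - 1)) := by
    refine intervalIntegral.integral_congr_ae ?_
    filter_upwards [hne] with s hs hst
    rw [uIoc_of_le ht.1] at hst
    exact chordDeriv_of_mem ⟨hst.1, lt_of_le_of_ne (hst.2.trans ht.2) hs⟩
  rw [h1, intervalIntegral.integral_sub (by simp)
    ((intervalIntegral.intervalIntegrable_rpow' (by linarith)).const_mul _),
    intervalIntegral.integral_const_mul, integral_rpow (Or.inl (by linarith))]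
  simp only [sub_add_cancel, Real.zero_rpow hα.ne', intervalIntegral.integral_const, smul_eq_mul]
  field_simp
  ring

lemma integral_chordDeriv (hα : 0 < α) (hb : 0 < b) : ∫ t, chordDeriv α b t = 0 := by
  have h := integral_chordDeriv_of_mem hα (right_mem_Icc.2 hb.le : b ∈ Icc 0 b)
  have hz : ∀ t ∉ Ioc 0 b, chordDeriv α b t = 0 := fun t ht =>
    chordDeriv_of_notMem fun h => ht ⟨h.1, h.2.le⟩
  rw [intervalIntegral.integral_of_le hb.le, setIntegral_eq_integral_of_forall_compl_eq_zero hz] at h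
  rw [h, ← Real.rpow_add_one hb.ne', sub_add_cancel, sub_self]

/-- The radial competitor, as an element of `W^{1,n}_0` of the annulus. -/
lemma memSobolevZero_chord (hn : 2 ≤ n) (hα : 1 - 1 / (n : ℝ) < α) (hb : 0 < b) {γ : ℝ≥0∞}
    (hbγ : ∀ t ∈ Ioo 0 b, ENNReal.ofReal (Real.exp t) < γ) :
    MemSobolevZero n (annulus n 1 γ) (fun x => ∫ s in (0 : ℝ)..Real.log ‖x‖, chordDeriv α b s)
      (fun x => (chordDeriv α b (Real.log ‖x‖) / ‖x‖ ^ 2) • x) :=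
  memSobolevZero_radial hn hb hbγ measurable_chordDeriv contDiffOn_chordDeriv
    (fun _ ht => chordDeriv_of_notMem ht) (memLp_chordDeriv hn hα hb.le)
    (integral_chordDeriv (pos_of_one_sub_inv_lt hn hα) hb)

lemma logPowerGrad_add_chord {x : EuclideanSpace ℝ (Fin n)} (hx : Real.log ‖x‖ ∈ Ioo 0 b) :
    logPowerGrad n 1 α x + (chordDeriv α b (Real.log ‖x‖) / ‖x‖ ^ 2) • x =
      logPowerGrad n (b ^ (α - 1)) 1 x := by
  rw [chordDeriv_of_mem hx, logPowerGrad, logPowerGrad, ← add_smul]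
  congr 1
  simp
  ring

/-- On (0, b) the difference is t(b^{α-1} - t^{α-1}), nonzero as soon as α ≠ 1. The set on which
energies are compared is therefore exactly the annulus 0 < log|x| < b. -/
lemma chord_ne_zero_iff (hα : 0 < α) (hα1 : α ≠ 1) (hb : 0 < b) (t : ℝ) :
    ∫ s in (0 : ℝ)..t, chordDeriv α b s ≠ 0 ↔ t ∈ Ioo 0 b := by
  refine ⟨fun h => ?_, fun ht => ?_⟩
  · by_contra ht
    exact h (integral_eq_zero_of_notMem_Ioo hb (fun _ h => chordDeriv_of_notMem h)
      (integral_chordDeriv hα hb) ht)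
  · rw [integral_chordDeriv_of_mem hα ⟨ht.1.le, ht.2.le⟩]
    intro h
    have h1 : t ^ α = t ^ (α - 1) * t := by rw [← Real.rpow_add_one ht.1.ne', sub_add_cancel]
    rw [h1, ← sub_mul, mul_eq_zero, or_iff_left ht.1.ne', sub_eq_zero,
      Real.rpow_left_inj hb.le ht.1.le (sub_ne_zero.2 hα1)] at h
    exact ht.2.ne' h

/-- For α ≥ 1 the convex function t^α lies below its chord from 0, so the competitor is admissible
for superminimizers; `chord_nonpos` is the concave counterpart. -/
lemma chord_nonneg (hα : 1 ≤ α) (hb : 0 < b) (t : ℝ) :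
    0 ≤ ∫ s in (0 : ℝ)..t, chordDeriv α b s := by
  have hα0 : 0 < α := by linarith
  by_cases ht : t ∈ Ioo 0 b
  · rw [integral_chordDeriv_of_mem hα0 ⟨ht.1.le, ht.2.le⟩]
    have h1 : t ^ α = t ^ (α - 1) * t := by rw [← Real.rpow_add_one ht.1.ne', sub_add_cancel]
    rw [h1, ← sub_mul]
    exact mul_nonneg (sub_nonneg.2 (Real.rpow_le_rpow ht.1.le ht.2.le (by linarith))) ht.1.le
  · exact (integral_eq_zero_of_notMem_Ioo hb (fun _ h => chordDeriv_of_notMem h)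
      (integral_chordDeriv hα0 hb) ht).ge

lemma chord_nonpos (hα0 : 0 < α) (hα : α ≤ 1) (hb : 0 < b) (t : ℝ) :
    ∫ s in (0 : ℝ)..t, chordDeriv α b s ≤ 0 := by
  by_cases ht : t ∈ Ioo 0 b
  · rw [integral_chordDeriv_of_mem hα0 ⟨ht.1.le, ht.2.le⟩]
    have h1 : t ^ α = t ^ (α - 1) * t := by rw [← Real.rpow_add_one ht.1.ne', sub_add_cancel]
    rw [h1, ← sub_mul]
    exact mul_nonpos_of_nonpos_of_nonneg (sub_nonpos.2
      (Real.rpow_le_rpow_of_nonpos ht.1 ht.2.le (by linarith))) ht.1.le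
  · exact (integral_eq_zero_of_notMem_Ioo hb (fun _ h => chordDeriv_of_notMem h)
      (integral_chordDeriv hα0 hb) ht).le

lemma logPowerConst_one (n : ℕ) : logPowerConst n 1 = 1 := by
  simp [logPowerConst]

lemma one_sub_inv_lt_one (hn : 2 ≤ n) : 1 - 1 / (n : ℝ) < 1 := by
  have : 0 < 1 / (n : ℝ) := by positivity
  linarith

lemma energy_logPowerGrad (hn : 2 ≤ n) (hα : 1 - 1 / (n : ℝ) < α) (hb : 0 < b) {c : ℝ}
    (hc : 0 ≤ c) {S : Set (EuclideanSpace ℝ (Fin n))} (hS : MeasurableSet S)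
    (hSb : ∀ (θ : Metric.sphere (0 : EuclideanSpace ℝ (Fin n)) 1) (t : ℝ),
      Real.exp t • (θ : EuclideanSpace ℝ (Fin n)) ∈ S ↔ t ∈ Ioo 0 b) :
    energy n S (logPowerGrad n c α) =
      (volume : Measure (EuclideanSpace ℝ (Fin n))).toSphere univ *
        ENNReal.ofReal (c ^ n * logPowerConst n α * b ^ ((n : ℝ) * α - n + 1)) := by
  rw [energy_eq_lintegral_logPolar (by omega) hS (measurable_logPowerGrad n c α)]
  simp_rw [exp_pow_mul_enorm_logPowerGrad, hSb, ofPred_mem_eq]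
  rw [lintegral_deriv_rpow_pow hn hα hc le_rfl hb.le, lintegral_const, mul_comm,
    Real.zero_rpow (logPowerConst_denom_pos hn hα).ne', sub_zero]

lemma energy_chord (hn : 2 ≤ n) (hb : 0 < b) (α : ℝ) {S : Set (EuclideanSpace ℝ (Fin n))}
    (hS : MeasurableSet S)
    (hSb : ∀ (θ : Metric.sphere (0 : EuclideanSpace ℝ (Fin n)) 1) (t : ℝ),
      Real.exp t • (θ : EuclideanSpace ℝ (Fin n)) ∈ S ↔ t ∈ Ioo 0 b) :
    energy n S (logPowerGrad n (b ^ (α - 1)) 1) =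
      (volume : Measure (EuclideanSpace ℝ (Fin n))).toSphere univ *
        ENNReal.ofReal (b ^ ((n : ℝ) * α - n + 1)) := by
  rw [energy_logPowerGrad hn (one_sub_inv_lt_one hn) hb (by positivity) hS hSb, logPowerConst_one,
    mul_one, ← Real.rpow_natCast, ← Real.rpow_mul hb.le, ← Real.rpow_add hb]
  ring_nf

/-- The equality case a = 0 of the comparison: both energies are multiples of b^β, and the affine
profile has coefficient 1. It yields both the sharpness of the constant and the maximal energy. -/
lemma energy_logPowerGrad_eq_mul_energy_chord (hn : 2 ≤ n) (hα : 1 - 1 / (n : ℝ) < α) (hb : 0 < b)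
    {S : Set (EuclideanSpace ℝ (Fin n))} (hS : MeasurableSet S)
    (hSb : ∀ (θ : Metric.sphere (0 : EuclideanSpace ℝ (Fin n)) 1) (t : ℝ),
      Real.exp t • (θ : EuclideanSpace ℝ (Fin n)) ∈ S ↔ t ∈ Ioo 0 b) :
    energy n S (logPowerGrad n 1 α) =
      ENNReal.ofReal (logPowerConst n α) * energy n S (logPowerGrad n (b ^ (α - 1)) 1) := by
  have hQ := one_le_logPowerConst hn hα
  rw [energy_chord hn hb α hS hSb, energy_logPowerGrad hn hα hb zero_le_one hS hSb, one_pow, one_mul,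
    ENNReal.ofReal_mul (by linarith)]
  ring

lemma exp_smul_mem_support_chord (hα : 0 < α) (hα1 : α ≠ 1) (hb : 0 < b) {γ : ℝ≥0∞}
    (hbγ : ∀ t ∈ Ioo 0 b, ENNReal.ofReal (Real.exp t) < γ)
    (θ : Metric.sphere (0 : EuclideanSpace ℝ (Fin n)) 1) (t : ℝ) :
    Real.exp t • (θ : EuclideanSpace ℝ (Fin n)) ∈
      {x ∈ annulus n 1 γ | ∫ s in (0 : ℝ)..Real.log ‖x‖, chordDeriv α b s ≠ 0} ↔ t ∈ Ioo 0 b := by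
  rw [mem_ofPred_eq, exp_smul_mem_annulus, norm_exp_smul, Real.log_exp,
    chord_ne_zero_iff hα hα1 hb]
  exact ⟨fun h => h.2, fun h => ⟨⟨h.1, hbγ t h⟩, h⟩⟩

/-- The radial competitor forces the constant to be at least `logPowerConst n α`. -/
theorem logPowerConst_le_of_energy_chord_le (hn : 2 ≤ n) (hα : 1 - 1 / (n : ℝ) < α) (hα1 : α ≠ 1)
    (hb : 0 < b) {γ : ℝ≥0∞} (hbγ : ∀ t ∈ Ioo 0 b, ENNReal.ofReal (Real.exp t) < γ) {Q : ℝ}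
    (hQ : 0 ≤ Q) {g : EuclideanSpace ℝ (Fin n) → EuclideanSpace ℝ (Fin n)}
    (hg : g =ᵐ[volume.restrict (annulus n 1 γ)] logPowerGrad n 1 α)
    (h : energy n {x ∈ annulus n 1 γ | ∫ s in (0 : ℝ)..Real.log ‖x‖, chordDeriv α b s ≠ 0} g ≤
      ENNReal.ofReal Q *
        energy n {x ∈ annulus n 1 γ | ∫ s in (0 : ℝ)..Real.log ‖x‖, chordDeriv α b s ≠ 0}
          (g + fun x => (chordDeriv α b (Real.log ‖x‖) / ‖x‖ ^ 2) • x)) :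
    logPowerConst n α ≤ Q := by
  have hα0 := pos_of_one_sub_inv_lt hn hα
  have hΩm : MeasurableSet (annulus n 1 γ) := (isOpen_annulus n 1 γ).measurableSet
  set S := {x ∈ annulus n 1 γ | ∫ s in (0 : ℝ)..Real.log ‖x‖, chordDeriv α b s ≠ 0} with hS
  have hS' : S = annulus n 1 γ ∩ (fun x => Real.log ‖x‖) ⁻¹' Ioo 0 b := by
    ext x
    simp only [hS, mem_ofPred_eq, mem_inter_iff, mem_preimage, chord_ne_zero_iff hα0 hα1 hb]
  have hSm : MeasurableSet S := by
    rw [hS']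
    exact hΩm.inter ((Real.measurable_log.comp measurable_norm) measurableSet_Ioo)
  have hSb := fun θ t => exp_smul_mem_support_chord (n := n) hα0 hα1 hb hbγ θ t
  have e1 : energy n S g = energy n S (logPowerGrad n 1 α) :=
    energy_congr (sep_subset _ _) (EventuallyEq.refl _ _) hg
  have e2 : energy n S (g + fun x => (chordDeriv α b (Real.log ‖x‖) / ‖x‖ ^ 2) • x) =
      energy n S (logPowerGrad n (b ^ (α - 1)) 1) := by
    refine energy_congr (Ω := S) Subset.rfl (EventuallyEq.refl _ _) ?_
    filter_upwards [ae_mono (Measure.restrict_mono (sep_subset _ _) le_rfl) hg,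
      ae_restrict_mem hSm] with x hx hxS
    rw [hS'] at hxS
    rw [Pi.add_apply, hx, logPowerGrad_add_chord hxS.2]
  have hE : Nontrivial (EuclideanSpace ℝ (Fin n)) := by
    have : Nonempty (Fin n) := ⟨⟨0, by omega⟩⟩
    infer_instance
  -- The common factor may be cancelled only because the sphere has positive finite measure.
  have hσ0 : (volume : Measure (EuclideanSpace ℝ (Fin n))).toSphere univ ≠ 0 :=
    fun h => Measure.toSphere_ne_zero _ (Measure.measure_univ_eq_zero.1 h)
  rw [e1, e2, energy_logPowerGrad_eq_mul_energy_chord hn hα hb hSm hSb,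
    ENNReal.mul_le_mul_iff_left] at h
  · exact (ENNReal.ofReal_le_ofReal_iff hQ).1 h
  · rw [energy_chord hn hb α hSm hSb]
    exact mul_ne_zero hσ0 (by simp; positivity)
  · rw [energy_chord hn hb α hSm hSb]
    exact ENNReal.mul_ne_top (measure_ne_top _ _) ENNReal.ofReal_ne_top

end Chord

/-! ### Best constants and maximal energy -/

section Main

variable {n : ℕ} {α : ℝ} {γ : ℝ≥0∞}

/-- A small annulus next to the unit sphere suffices for sharpness, so γ = ∞ needs no separate
treatment. -/
lemma exists_interval_exp_lt (hγ : 1 < γ) :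
    ∃ b > 0, ∀ t ∈ Ioo 0 b, ENNReal.ofReal (Real.exp t) < γ := by
  obtain ⟨r, hr1, hrγ⟩ := ENNReal.lt_iff_exists_nnreal_btwn.1 hγ
  have hr : (1 : ℝ) < r := by exact_mod_cast hr1
  refine ⟨Real.log r, Real.log_pos hr, fun t ht => lt_trans ?_ hrγ⟩
  rw [← ENNReal.ofReal_coe_nnreal]
  refine (ENNReal.ofReal_lt_ofReal_iff (by linarith)).2 ?_
  rw [← Real.exp_log (by linarith : (0 : ℝ) < r)]
  exact Real.exp_lt_exp.2 ht.2

lemma isQuasiminimizer_const_mul_logPower (hn : 2 ≤ n) (hα : 1 - 1 / (n : ℝ) < α) {c : ℝ}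
    (hc : 0 < c) :
    IsQuasiminimizer n (logPowerConst n α) (annulus n 1 γ) (fun x => c * logPower n α x) :=
  ⟨one_le_logPowerConst hn hα, logPowerGrad n c α, memSobolevLoc_const_mul_logPower γ n c α,
    fun _ _ hφ => energy_logPowerGrad_le_logPowerConst_mul hn hα hc hφ⟩

lemma isQuasiminimizer_logPower (hn : 2 ≤ n) (hα : 1 - 1 / (n : ℝ) < α) :
    IsQuasiminimizer n (logPowerConst n α) (annulus n 1 γ) (logPower n α) := by
  simpa using isQuasiminimizer_const_mul_logPower (γ := γ) hn hα one_pos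

lemma IsQuasiminimizer.isQuasisuperminimizer {p Q : ℝ} {Ω : Set (EuclideanSpace ℝ (Fin n))}
    {u : EuclideanSpace ℝ (Fin n) → ℝ} (h : IsQuasiminimizer p Q Ω u) :
    IsQuasisuperminimizer p Q Ω u := by
  obtain ⟨hQ, g, hg, hle⟩ := h
  exact ⟨hQ, g, hg, fun φ h hφ _ => hle φ h hφ⟩

lemma logPowerGrad_neg_one (n : ℕ) (α : ℝ) : logPowerGrad n (-1) α = -logPowerGrad n 1 α := by
  ext1 x
  simp [logPowerGrad, neg_div]

lemma memSobolevLoc_neg_logPower (γ : ℝ≥0∞) (p α : ℝ) :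
    MemSobolevLoc p (annulus n 1 γ) (-logPower n α) (-logPowerGrad n 1 α) := by
  rw [← logPowerGrad_neg_one]
  convert memSobolevLoc_const_mul_logPower (n := n) γ p (-1) α using 1
  ext x
  simp

/-- Changing the sign of both the function and the perturbation turns nonnegative perturbations of
-u into nonpositive perturbations of u. -/
lemma isQuasisubminimizer_of_energy_le {Q : ℝ} (hn : 2 ≤ n) (hQ : 1 ≤ Q)
    (h : ∀ φ h, MemSobolevZero n (annulus n 1 γ) φ h →
      (∀ᵐ x ∂(volume.restrict (annulus n 1 γ)), φ x ≤ 0) →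
      energy n {x ∈ annulus n 1 γ | φ x ≠ 0} (logPowerGrad n 1 α) ≤
        ENNReal.ofReal Q *
          energy n {x ∈ annulus n 1 γ | φ x ≠ 0} (logPowerGrad n 1 α + h)) :
    IsQuasisubminimizer n Q (annulus n 1 γ) (logPower n α) := by
  refine ⟨hQ, -logPowerGrad n 1 α, memSobolevLoc_neg_logPower γ n α, fun φ k hφ hφ0 => ?_⟩
  have h1 := h (-φ) (-k) (hφ.neg (isOpen_annulus n 1 γ) (by exact_mod_cast (by omega : 1 ≤ n)))
    (by filter_upwards [hφ0] with x hx
        simpa using hx)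
  simp only [Pi.neg_apply, ne_eq, neg_eq_zero] at h1
  rw [energy_neg, ← energy_neg n _ (-logPowerGrad n 1 α + k), neg_add, neg_neg]
  exact h1

lemma isQuasisubminimizer_logPower (hn : 2 ≤ n) (hα : 1 - 1 / (n : ℝ) < α) :
    IsQuasisubminimizer n (logPowerConst n α) (annulus n 1 γ) (logPower n α) :=
  isQuasisubminimizer_of_energy_le hn (one_le_logPowerConst hn hα) fun _ _ hφ _ =>
    energy_logPowerGrad_le_logPowerConst_mul hn hα one_pos hφ

lemma isQuasisubminimizer_one_logPower (hn : 2 ≤ n) (hα : 1 ≤ α) :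
    IsQuasisubminimizer n 1 (annulus n 1 γ) (logPower n α) :=
  isQuasisubminimizer_of_energy_le hn le_rfl fun φ h hφ hφ0 => by
    rw [ENNReal.ofReal_one, one_mul]
    refine energy_logPowerGrad_le_of_sign hn ((one_sub_inv_lt_one hn).trans_le hα) one_pos hφ ?_
    filter_upwards [hφ0] with x hx
    exact mul_nonpos_of_nonneg_of_nonpos (by linarith) hx

lemma isQuasisuperminimizer_one_logPower (hn : 2 ≤ n) (hα : 1 - 1 / (n : ℝ) < α) (hα1 : α ≤ 1) :
    IsQuasisuperminimizer n 1 (annulus n 1 γ) (logPower n α) := by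
  refine ⟨le_rfl, logPowerGrad n 1 α, memSobolevLoc_logPower γ n α, fun φ h hφ hφ0 => ?_⟩
  rw [ENNReal.ofReal_one, one_mul]
  refine energy_logPowerGrad_le_of_sign hn hα one_pos hφ ?_
  filter_upwards [hφ0] with x hx
  exact mul_nonpos_of_nonpos_of_nonneg (by linarith) hx

lemma logPowerConst_le_of_isQuasisuperminimizer (hn : 2 ≤ n) (hα : 1 < α) (hγ : 1 < γ) {Q : ℝ}
    (h : IsQuasisuperminimizer n Q (annulus n 1 γ) (logPower n α)) : logPowerConst n α ≤ Q := by
  obtain ⟨hQ, g, hg, hle⟩ := h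
  obtain ⟨b, hb, hbγ⟩ := exists_interval_exp_lt hγ
  have hα' : 1 - 1 / (n : ℝ) < α := (one_sub_inv_lt_one hn).trans hα
  exact logPowerConst_le_of_energy_chord_le hn hα' hα.ne' hb hbγ (by linarith)
    -- The definition only asserts that some weak gradient works; by uniqueness it is the explicit
    -- one up to a null set.
    (hg.1.ae_eq (isOpen_annulus n 1 γ) (memSobolevLoc_logPower γ n α).1)
    (hle _ _ (memSobolevZero_chord hn hα' hb hbγ) (ae_of_all _ fun x => chord_nonneg hα.le hb _))

lemma logPowerConst_le_of_isQuasisubminimizer (hn : 2 ≤ n) (hα : 1 - 1 / (n : ℝ) < α) (hα1 : α < 1)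
    (hγ : 1 < γ) {Q : ℝ} (h : IsQuasisubminimizer n Q (annulus n 1 γ) (logPower n α)) :
    logPowerConst n α ≤ Q := by
  obtain ⟨hQ, g, hg, hle⟩ := h
  obtain ⟨b, hb, hbγ⟩ := exists_interval_exp_lt hγ
  have hα0 := pos_of_one_sub_inv_lt hn hα
  have hn1 : (1 : ℝ) ≤ n := by exact_mod_cast (by omega : 1 ≤ n)
  have h1 := hle _ _ ((memSobolevZero_chord hn hα hb hbγ).neg (isOpen_annulus n 1 γ) hn1)
    (ae_of_all _ fun x => by
      simpa using chord_nonpos hα0 hα1.le hb _)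
  have hg' : -g =ᵐ[volume.restrict (annulus n 1 γ)] logPowerGrad n 1 α := by
    have := hg.1.ae_eq (isOpen_annulus n 1 γ) (memSobolevLoc_neg_logPower γ n α).1
    simpa using this.neg
  refine logPowerConst_le_of_energy_chord_le hn hα hα1.ne hb hbγ (by linarith) hg' ?_
  simp only [Pi.neg_apply, ne_eq, neg_eq_zero] at h1
  rw [energy_neg, ← energy_neg n _ (-g + _), neg_add, neg_neg]
  exact h1

lemma logPowerConst_le_of_isQuasiminimizer (hn : 2 ≤ n) (hα : 1 - 1 / (n : ℝ) < α) (hγ : 1 < γ)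
    {Q : ℝ} (h : IsQuasiminimizer n Q (annulus n 1 γ) (logPower n α)) : logPowerConst n α ≤ Q := by
  obtain ⟨hQ, g, hg, hle⟩ := h
  -- For α = 1 the chord perturbation is zero and gives no information, but the claimed bound is
  -- then just `1 ≤ Q`.
  rcases eq_or_ne α 1 with rfl | hα1
  · rwa [logPowerConst_one]
  obtain ⟨b, hb, hbγ⟩ := exists_interval_exp_lt hγ
  exact logPowerConst_le_of_energy_chord_le hn hα hα1 hb hbγ (by linarith)
    (hg.1.ae_eq (isOpen_annulus n 1 γ) (memSobolevLoc_logPower γ n α).1)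
    (hle _ _ (memSobolevZero_chord hn hα hb hbγ))

theorem hasMaximalEnergy_logPower (hn : 2 ≤ n) (hα : 1 - 1 / (n : ℝ) < α) (hγ : 1 < γ)
    (hγ' : γ < ⊤) :
    HasMaximalEnergy n (logPowerConst n α) (annulus n 1 γ) (annulus n 1 γ) (logPower n α) := by
  have hα0 := pos_of_one_sub_inv_lt hn hα
  lift γ to NNReal using hγ'.ne
  have hr : (1 : ℝ) < γ := by exact_mod_cast hγ
  have hr0 : (0 : ℝ) < γ := by linarith
  set b := Real.log γ with hbd
  have hb : 0 < b := Real.log_pos hr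
  have hexp : ∀ t : ℝ, ENNReal.ofReal (Real.exp t) < (γ : ℝ≥0∞) ↔ t < b := fun t => by
    rw [← ENNReal.ofReal_coe_nnreal, ENNReal.ofReal_lt_ofReal_iff hr0, hbd,
      Real.lt_log_iff_exp_lt hr0]
  have hΩ := isOpen_annulus n 1 γ
  have hSb : ∀ (θ : Metric.sphere (0 : EuclideanSpace ℝ (Fin n)) 1) (t : ℝ),
      Real.exp t • (θ : EuclideanSpace ℝ (Fin n)) ∈ annulus n 1 γ ↔ t ∈ Ioo 0 b := fun θ t => by
    rw [exp_smul_mem_annulus, hexp, mem_Ioo]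
  have hlog : ∀ x ∈ annulus n 1 γ, Real.log ‖x‖ ∈ Ioo 0 b := fun x hx => by
    have h1 := one_lt_norm_of_mem_annulus hx
    refine ⟨Real.log_pos h1, (hexp _).1 ?_⟩
    rw [Real.exp_log (by linarith), ofReal_norm]
    exact hx.2
  have hc : 0 < b ^ (α - 1) := by positivity
  -- The minimizer v = b^{α-1} log|x| is the chord over all of (0, log γ); it matches u at both
  -- boundary spheres.
  refine ⟨isQuasiminimizer_logPower hn hα, hΩ, Subset.rfl, logPowerGrad n 1 α,
    fun x => b ^ (α - 1) * logPower n 1 x, logPowerGrad n (b ^ (α - 1)) 1,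
    memSobolevLoc_logPower _ n α, memSobolevLoc_const_mul_logPower _ n _ 1, ?_, ?_,
    energy_logPowerGrad_eq_mul_energy_chord hn hα hb hΩ.measurableSet hSb, ?_⟩
  · simpa only [logPowerConst_one] using
      isQuasiminimizer_const_mul_logPower (γ := γ) hn (one_sub_inv_lt_one hn) hc
  · refine (memSobolevZero_chord hn hα hb fun t ht => (hexp t).2 ht.2).congr hΩ
      (by exact_mod_cast (by omega : 1 ≤ n)) (fun x hx => ?_) fun x hx => ?_
    · rw [integral_chordDeriv_of_mem hα0 ⟨(hlog x hx).1.le, (hlog x hx).2.le⟩]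
      simp [logPower]
    · rw [Pi.sub_apply, ← logPowerGrad_add_chord (α := α) (hlog x hx), add_sub_cancel_left]
  · rw [energy_logPowerGrad hn hα hb zero_le_one hΩ.measurableSet hSb]
    exact ENNReal.mul_lt_top (measure_lt_top _ _) ENNReal.ofReal_lt_top

end Main

end QuasiMin

theorem theorem2p3 (n : ℕ) (hn : 2 ≤ n) (α : ℝ) (hα : 1 - 1 / (n : ℝ) < α)
    (γ : ENNReal) (hγ : 1 < γ) :
    -- best quasiminimizing constant
    IsLeast {Q : ℝ | QuasiMin.IsQuasiminimizer n Q (QuasiMin.annulus n 1 γ)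
      (QuasiMin.logPower n α)} (QuasiMin.logPowerConst n α) ∧
    -- the table of best constants
    (α < 1 →
      IsLeast {Q : ℝ | QuasiMin.IsQuasisubminimizer n Q (QuasiMin.annulus n 1 γ)
        (QuasiMin.logPower n α)} (QuasiMin.logPowerConst n α) ∧
      IsLeast {Q : ℝ | QuasiMin.IsQuasisuperminimizer n Q (QuasiMin.annulus n 1 γ)
        (QuasiMin.logPower n α)} 1) ∧
    (α = 1 →
      IsLeast {Q : ℝ | QuasiMin.IsQuasiminimizer n Q (QuasiMin.annulus n 1 γ)
        (QuasiMin.logPower n α)} 1 ∧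
      IsLeast {Q : ℝ | QuasiMin.IsQuasisubminimizer n Q (QuasiMin.annulus n 1 γ)
        (QuasiMin.logPower n α)} 1 ∧
      IsLeast {Q : ℝ | QuasiMin.IsQuasisuperminimizer n Q (QuasiMin.annulus n 1 γ)
        (QuasiMin.logPower n α)} 1) ∧
    (1 < α →
      IsLeast {Q : ℝ | QuasiMin.IsQuasisubminimizer n Q (QuasiMin.annulus n 1 γ)
        (QuasiMin.logPower n α)} 1 ∧
      IsLeast {Q : ℝ | QuasiMin.IsQuasisuperminimizer n Q (QuasiMin.annulus n 1 γ)
        (QuasiMin.logPower n α)} (QuasiMin.logPowerConst n α)) ∧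
    -- maximal energy
    (γ < ⊤ → QuasiMin.HasMaximalEnergy n (QuasiMin.logPowerConst n α)
      (QuasiMin.annulus n 1 γ) (QuasiMin.annulus n 1 γ) (QuasiMin.logPower n α)) := by
  -- Wherever the best constant is 1, minimality is the clause `1 ≤ Q` in the definitions, extracted
  -- as `hQ.1`.
  refine ⟨⟨QuasiMin.isQuasiminimizer_logPower hn hα, fun Q hQ =>
      QuasiMin.logPowerConst_le_of_isQuasiminimizer hn hα hγ hQ⟩,
    fun h => ⟨⟨QuasiMin.isQuasisubminimizer_logPower hn hα, fun Q hQ =>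
      QuasiMin.logPowerConst_le_of_isQuasisubminimizer hn hα h hγ hQ⟩,
      ⟨QuasiMin.isQuasisuperminimizer_one_logPower hn hα h.le, fun Q hQ => hQ.1⟩⟩,
    fun h => ⟨⟨?_, fun Q hQ => hQ.1⟩,
      ⟨QuasiMin.isQuasisubminimizer_one_logPower hn h.ge, fun Q hQ => hQ.1⟩,
      ⟨QuasiMin.isQuasisuperminimizer_one_logPower hn hα h.le, fun Q hQ => hQ.1⟩⟩,
    fun h => ⟨⟨QuasiMin.isQuasisubminimizer_one_logPower hn h.le, fun Q hQ => hQ.1⟩,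
      ⟨(QuasiMin.isQuasiminimizer_logPower hn hα).isQuasisuperminimizer, fun Q hQ =>
        QuasiMin.logPowerConst_le_of_isQuasisuperminimizer hn h hγ hQ⟩⟩,
    fun h => QuasiMin.hasMaximalEnergy_logPower hn hα hγ h⟩
  subst h
  have := QuasiMin.isQuasiminimizer_logPower (γ := γ) hn hα
  rwa [QuasiMin.logPowerConst_one] at this
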